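/- Definitions. For a compact set $K\subset\mathbb R^d$ and $u\in\mathbb R^d$ put $h(K,u)=\sup\{\langle u,x\rangle : x\in K\}$, $H(K,u)=\{x : \langle u,x\rangle=h(K,u)\}$, and let $\omega(K)=\inf\{h(K,u)+h(K,-u) : \|u\|=1\}$ be the minimum width of $K$. A convex body is a compact convex set with non-empty interior; a convex body $K$ is reduced if $\omega(K')<\omega(K)$ for every convex body $K'\subsetneq K$. A polytope is the convex hull of finitely many points; the faces of a polytope $P$ are the sets $H(P,u)\cap P$ with $u\neq 0$, and faces of affine dimension $0$, $1$, $d-1$ are called vertices, edges and facets. An edge with end points $x,y$ is written $xy$. Distinct faces $F_1,F_2$ of $P$ are strictly antipodal if there is a unit vector $u$ with $H(P,u)\cap P=F_1$ and $H(P,-u)\cap P=F_2$. Finally, $\rho(A,B)=\inf\{\|x-y\| : x\in\operatorname{aff}(A),\ y\in\operatorname{aff}(B)\}$. Theorem. Let $P\subset\mathbb R^3$ be a reduced polytope. Let $F$ be a facet of $P$ with edges $a_1a_2,\dots,a_{k-1}a_k,a_ka_1$ (where $a_1,\dots,a_k$ are distinct), and let $v$ be a vertex of $P$. Suppose that the edges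 of $P$ incident to $v$ are, in this cyclic order around $v$ and without repetition, $$vv_{1,1},\dots,vv_{1,i_1},\ vv_{2,1},\dots,vv_{2,i_2},\ \dots,\ vv_{k,1},\dots,vv_{k,i_k},$$ where $i_1,\dots,i_k$ are positive integers. For $1\le j\le k$ and $1\le l\le i_j$ let $F_{j,l}$ be the facet of $P$ that contains the edge $vv_{j,l}$ and the edge following it in this cyclic list (that is, $vv_{j,l+1}$ if $l<i_j$; $vv_{j+1,1}$ if $l=i_j$ and $j<k$; $vv_{1,1}$ if $l=i_k$ and $j=k$). Then the following three conditions cannot all hold: (a) $F$ and $\{v\}$ are strictly antipodal, and $\rho(\{v\},F)=\omega(P)$. (b) For every $j\in\{1,\dots,k\}$, the edges $vv_{j,1}$ and $a_{j-1}a_j$ are strictly antipodal, where $a_0=a_k$. (c) For every $j\in\{1,\dots,k\}$, each of the facets $F_{j,1},\dots,F_{j,i_j}$ is strictly antipodal to $\{a_j\}$, and there is an $l\in\{1,\dots,i_j\}$ with $\rho(\{a_j\},F_{j,l})=\omega(P)$. -/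

import Mathlib

noncomputable section

namespace ReducedPolytope

/-- `d`-dimensional Euclidean space. -/
abbrev Space (d : ℕ) : Type := EuclideanSpace ℝ (Fin d)

variable {d : ℕ}

/-- The support function `h(K, u) = sup {⟨u, x⟩ | x ∈ K}`. -/
def supportFn (K : Set (Space d)) (u : Space d) : ℝ :=
  sSup ((fun x : Space d => inner ℝ u x) '' K)

/-- `H(K, u) = {x | ⟨u, x⟩ = h(K, u)}`, the supporting hyperplane of `K` with outer normal `u`
(for `u ≠ 0`). -/
def supportingHyperplane (K : Set (Space d)) (u : Space d) : Set (Space d) :=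
  {x | inner ℝ u x = supportFn K u}

/-- The width `w(K, u) = h(K, -u) + h(K, u)` of `K` in direction `u`. -/
def width (K : Set (Space d)) (u : Space d) : ℝ :=
  supportFn K (-u) + supportFn K u

/-- The minimum width `ω(K) = inf {w(K, u) | ‖u‖ = 1}`. -/
def minWidth (K : Set (Space d)) : ℝ :=
  sInf {r : ℝ | ∃ u : Space d, ‖u‖ = 1 ∧ r = width K u}

/-- Convex bodies: convex compact sets with non-empty interior. -/
def IsConvexBody (K : Set (Space d)) : Prop :=
  Convex ℝ K ∧ IsCompact K ∧ (interior K).Nonempty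

/-- A convex body is reduced if every convex body properly contained in it has smaller minimum
width. -/
def IsReduced (K : Set (Space d)) : Prop :=
  IsConvexBody K ∧ ∀ K' : Set (Space d), IsConvexBody K' → K' ⊂ K → minWidth K' < minWidth K

/-- A polytope is the convex hull of finitely many points. -/
def IsPolytope (P : Set (Space d)) : Prop :=
  ∃ S : Set (Space d), S.Finite ∧ P = convexHull ℝ S

/-- The affine dimension: the dimension of the affine hull. -/
def affineDim (A : Set (Space d)) : ℕ :=
  Module.finrank ℝ (affineSpan ℝ A).direction

/-- Faces of `P`: intersections of `P` with its supporting hyperplanes. -/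
def IsFace (P F : Set (Space d)) : Prop :=
  ∃ u : Space d, u ≠ 0 ∧ supportingHyperplane P u ∩ P = F

/-- `v` is a vertex of `P`: `{v}` is a face (necessarily of affine dimension `0`). -/
def IsVertex (P : Set (Space d)) (v : Space d) : Prop :=
  IsFace P {v}

/-- Edges: faces of affine dimension `1`. -/
def IsEdge (P e : Set (Space d)) : Prop :=
  IsFace P e ∧ affineDim e = 1

/-- Facets: faces of affine dimension `d - 1`. -/
def IsFacet (P F : Set (Space d)) : Prop :=
  IsFace P F ∧ affineDim F + 1 = d

/-- Distinct faces `F₁`, `F₂` of `P` are strictly antipodal if `H(P, u) ∩ P = F₁` and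
`H(P, -u) ∩ P = F₂` for some unit vector `u`. -/
def StrictlyAntipodal (P F₁ F₂ : Set (Space d)) : Prop :=
  IsFace P F₁ ∧ IsFace P F₂ ∧ F₁ ≠ F₂ ∧
    ∃ u : Space d, ‖u‖ = 1 ∧
      supportingHyperplane P u ∩ P = F₁ ∧ supportingHyperplane P (-u) ∩ P = F₂

/-- `ρ(A, B)`: the minimal distance between points of the affine hulls of `A` and `B`. -/
def rho (A B : Set (Space d)) : ℝ :=
  sInf {r : ℝ | ∃ x ∈ affineSpan ℝ A, ∃ y ∈ affineSpan ℝ B, r = ‖x - y‖}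

/-- For a family `w j l` arranged in `k` non-empty blocks, the `j`-th one of size `i j`, the entry
that follows `w j l` when the blocks are read cyclically one after the other: `w j (l + 1)` inside
block `j`, and the first entry of block `j + 1` (cyclically) after the last entry of block `j`. -/
def blockNext {α : Type*} {k : ℕ} [NeZero k] {i : Fin k → ℕ} (hi : ∀ j, 0 < i j)
    (w : (j : Fin k) → Fin (i j) → α) (j : Fin k) (l : Fin (i j)) : α :=
  if h : l.val + 1 < i j then w j ⟨l.val + 1, h⟩ else w (j + 1) ⟨0, hi (j + 1)⟩

end ReducedPolytope

end

open ReducedPolytope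

namespace ReducedPolytope
open MeasureTheory Filter Topology

/-! Two closed chains of angles at `v` are compared. Put `A_j = a_j - v`, let `n` be the unit outer
normal of `F`, and let `x_j = A_j - ω n`, the vector from the foot of `v` in the plane of `F` to
`a_j`. Since the width is minimal in direction `n`, first-order optimality puts this foot in `F`, so
the `x_j` lie in no open half space and the angles between consecutive ones add up to at least `2π`.

For each `j`, condition (c) gives a facet at `v`, with unit outer normal `g_j`, at distance `ω` from
`a_j`. The same optimality argument (`foot_mem_cone`) puts `q_j = A_j + ω g_j`, the foot of `a_j`
seen from `v`, in the cone of that facet, between two consecutive edge directions. Moreover `|q_j| =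
|x_j|`, both being legs of right triangles with hypotenuse `|A_j|` and other leg `ω`.

Let `b_j` be the direction of the first edge of block `j`. By (b) there are parallel supporting
planes, at distance `D ≥ ω`, through this edge and through `a_{j-1}a_j`. A computation with scalar
products (`angle_le_angle_add_angle`) then gives `∠(x_{j-1}, x_j) ≤ ∠(q_{j-1}, b_j) + ∠(b_j, q_j)`.
Summed over `j`, the right side is at most the sum of the facet angles at `v`, which is less than
`2π` because `v` is a vertex of a convex polytope: a contradiction.

Angles are measured in the manner of Crofton: `splitVol x y` is the volume of the `u` in the unit
ball whose plane `u^⊥` separates `x` from `y`, and `2π` becomes twice the volume of the ball. Both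
bounds on total angles turn into counts of crossings with a generic plane: at least two for the
chain `x_j`, at most two for the edges at `v`, and none for an open set of planes. -/

/-! ### Support functions, slabs and minimum width. -/

lemma inner_le_supportFn {d : ℕ} {K : Set (Space d)} (hK : IsCompact K) (u : Space d) {x : Space d}
    (hx : x ∈ K) : inner ℝ u x ≤ supportFn K u :=
  le_csSup (hK.image (by fun_prop)).bddAbove (Set.mem_image_of_mem _ hx)

lemma supportFn_le {d : ℕ} {K : Set (Space d)} (hne : K.Nonempty) {u : Space d} {c : ℝ}
    (h : ∀ x ∈ K, inner ℝ u x ≤ c) : supportFn K u ≤ c :=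
  csSup_le (hne.image _) (by rintro _ ⟨x, hx, rfl⟩; exact h x hx)

lemma supportFn_eq {d : ℕ} {K : Set (Space d)} {u x₀ : Space d} (hx₀ : x₀ ∈ K)
    (h : ∀ x ∈ K, inner ℝ u x ≤ inner ℝ u x₀) : supportFn K u = inner ℝ u x₀ :=
  IsGreatest.csSup_eq ⟨Set.mem_image_of_mem _ hx₀, by rintro _ ⟨x, hx, rfl⟩; exact h x hx⟩

lemma width_nonneg {d : ℕ} {K : Set (Space d)} (hK : IsCompact K) (hne : K.Nonempty)
    (u : Space d) : 0 ≤ width K u := by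
  obtain ⟨x, hx⟩ := hne
  have h1 := inner_le_supportFn hK u hx
  have h2 := inner_le_supportFn hK (-u) hx
  rw [inner_neg_left] at h2
  unfold width
  linarith

lemma minWidth_le_width {d : ℕ} {K : Set (Space d)} (hK : IsCompact K) (hne : K.Nonempty)
    {u : Space d} (hu : ‖u‖ = 1) : minWidth K ≤ width K u :=
  csInf_le ⟨0, by rintro _ ⟨u, -, rfl⟩; exact width_nonneg hK hne u⟩ ⟨u, hu, rfl⟩

/-- A slab with normal vector of length at least one that contains `K` is at least as wide as
the minimum width of `K`. -/
lemma minWidth_le_sub {d : ℕ} {K : Set (Space d)} (hK : IsCompact K) (hne : K.Nonempty)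
    {z : Space d} (hz : 1 ≤ ‖z‖) {α β : ℝ} (hα : ∀ x ∈ K, inner ℝ z x ≤ α)
    (hβ : ∀ x ∈ K, β ≤ inner ℝ z x) : minWidth K ≤ α - β := by
  have hz0 : 0 < ‖z‖ := by linarith
  have hu : ‖(‖z‖⁻¹ • z)‖ = 1 := by
    rw [norm_smul, norm_inv, norm_norm, inv_mul_cancel₀ hz0.ne']
  have h1 : width K (‖z‖⁻¹ • z) ≤ ‖z‖⁻¹ * (α - β) := by
    have e1 : supportFn K (‖z‖⁻¹ • z) ≤ ‖z‖⁻¹ * α := supportFn_le hne fun x hx => by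
      rw [real_inner_smul_left]
      exact mul_le_mul_of_nonneg_left (hα x hx) (by positivity)
    have e2 : supportFn K (-(‖z‖⁻¹ • z)) ≤ ‖z‖⁻¹ * (-β) := supportFn_le hne fun x hx => by
      rw [inner_neg_left, real_inner_smul_left, ← mul_neg]
      exact mul_le_mul_of_nonneg_left (neg_le_neg (hβ x hx)) (by positivity)
    unfold width
    linarith
  have h2 := minWidth_le_width hK hne hu
  obtain ⟨x, hx⟩ := hne
  have h3 : 0 ≤ α - β := by linarith [hα x hx, hβ x hx]
  have h4 : ‖z‖⁻¹ * (α - β) ≤ α - β := by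
    have : ‖z‖⁻¹ ≤ 1 := inv_le_one_of_one_le₀ hz
    nlinarith
  linarith

/-- The face of `P` in direction `u`, described through the value `c` of `u` on it. -/
lemma supportingHyperplane_inter_eq {d : ℕ} {P : Set (Space d)} {u x₀ : Space d} (hx₀ : x₀ ∈ P)
    (h : ∀ x ∈ P, inner ℝ u x ≤ inner ℝ u x₀) :
    supportingHyperplane P u ∩ P = {x | x ∈ P ∧ inner ℝ u x = inner ℝ u x₀} := by
  ext x
  simp [supportingHyperplane, supportFn_eq hx₀ h, and_comm]

lemma face_facts {d : ℕ} {P F : Set (Space d)} (hP : IsCompact P) {u x₀ : Space d}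
    (hF : supportingHyperplane P u ∩ P = F) (hx₀ : x₀ ∈ F) :
    x₀ ∈ P ∧ (∀ x ∈ P, inner ℝ u x ≤ inner ℝ u x₀) ∧
      ∀ x, x ∈ F ↔ x ∈ P ∧ inner ℝ u x = inner ℝ u x₀ := by
  subst hF
  have h0 : inner ℝ u x₀ = supportFn P u := hx₀.1
  refine ⟨hx₀.2, fun x hx => h0 ▸ inner_le_supportFn hP u hx, fun x => ?_⟩
  rw [h0]
  exact and_comm

/-! ### Faces of faces, and the edges of a facet. -/

/-- The face of a polytope in direction `n + ε u`, for small positive `ε`, is the face in direction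
`u` of the face in direction `n`. -/
lemma eventually_perturb {d : ℕ} {S P : Set (Space d)} (hS : S.Finite) (hPS : P = convexHull ℝ S)
    {n : Space d} (u : Space d) {h M : ℝ} (hn : ∀ x ∈ P, inner ℝ n x ≤ h)
    (hM : ∀ x ∈ P, inner ℝ n x = h → inner ℝ u x ≤ M) :
    ∀ᶠ ε in 𝓝[>] (0 : ℝ), ∀ x ∈ P, inner ℝ (n + ε • u) x < h + ε * M ∨
      (inner ℝ n x = h ∧ inner ℝ u x = M) := by
  have h1 : ∀ s ∈ S, ∀ᶠ ε in 𝓝[>] (0 : ℝ), inner ℝ (n + ε • u) s < h + ε * M ∨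
      (inner ℝ n s = h ∧ inner ℝ u s = M) := by
    intro s hs
    have hsP : s ∈ P := hPS ▸ subset_convexHull ℝ S hs
    rcases (hn s hsP).lt_or_eq with hlt | heq
    · have : ∀ᶠ ε in 𝓝 (0 : ℝ), inner ℝ n s + ε * inner ℝ u s < h + ε * M := by
        have hc : ContinuousAt (fun ε : ℝ => inner ℝ n s + ε * inner ℝ u s) 0 := by fun_prop
        have hc' : ContinuousAt (fun ε : ℝ => h + ε * M) 0 := by fun_prop
        exact hc.eventually_lt hc' (by simpa using hlt)
      filter_upwards [nhdsWithin_le_nhds this] with ε hε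
      left
      rw [inner_add_left, real_inner_smul_left]
      exact hε
    · rcases (hM s hsP heq).lt_or_eq with hlt' | heq'
      · filter_upwards [self_mem_nhdsWithin] with ε hε
        left
        rw [inner_add_left, real_inner_smul_left, heq]
        have := mul_lt_mul_of_pos_left hlt' (show (0 : ℝ) < ε from hε)
        linarith
      · exact Eventually.of_forall fun _ => Or.inr ⟨heq, heq'⟩
  -- The alternative holds at the finitely many generators for a common `ε`; it describes a convex
  -- set, hence passes to the hull.
  filter_upwards [(eventually_all_finite hS).2 h1] with ε hε
  have hconv : Convex ℝ {x : Space d | inner ℝ (n + ε • u) x < h + ε * M ∨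
      (inner ℝ n x = h ∧ inner ℝ u x = M)} := by
    intro x hx y hy α β hα hβ hαβ
    simp only [Set.mem_ofPred_eq, inner_add_left, inner_add_right, real_inner_smul_left,
      real_inner_smul_right] at hx hy ⊢
    have e0 : α * (h + ε * M) + β * (h + ε * M) = h + ε * M := by rw [← add_mul, hαβ, one_mul]
    rcases hα.eq_or_lt with rfl | hα
    · obtain rfl : β = 1 := by linarith
      simpa using hy
    rcases hβ.eq_or_lt with rfl | hβ
    · obtain rfl : α = 1 := by linarith
      simpa using hx
    rcases hx with hx | ⟨hx1, hx2⟩ <;> rcases hy with hy | ⟨hy1, hy2⟩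
    · left
      have := mul_lt_mul_of_pos_left hx hα
      have := mul_lt_mul_of_pos_left hy hβ
      linarith
    · left
      have := mul_lt_mul_of_pos_left hx hα
      rw [hy1, hy2]
      linarith
    · left
      have := mul_lt_mul_of_pos_left hy hβ
      rw [hx1, hx2]
      linarith
    · right
      rw [hx1, hx2, hy1, hy2, ← add_mul, ← add_mul, hαβ, one_mul, one_mul]
      exact ⟨rfl, rfl⟩
  intro x hx
  rw [hPS] at hx
  exact convexHull_min hε hconv hx

lemma eventually_perturb_le {d : ℕ} {S P : Set (Space d)} (hS : S.Finite)
    (hPS : P = convexHull ℝ S) {n : Space d} (u : Space d) {h M : ℝ}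
    (hn : ∀ x ∈ P, inner ℝ n x ≤ h) (hM : ∀ x ∈ P, inner ℝ n x = h → inner ℝ u x ≤ M) :
    ∀ᶠ ε in 𝓝[>] (0 : ℝ), ∀ x ∈ P, inner ℝ (n + ε • u) x ≤ h + ε * M := by
  filter_upwards [eventually_perturb hS hPS u hn hM] with ε hε x hx
  rcases hε x hx with h1 | ⟨h1, h2⟩
  · exact h1.le
  · rw [inner_add_left, real_inner_smul_left, h1, h2]

/-- A face of a polytope is generated by the generators that lie on it. -/
lemma face_inner_le {d : ℕ} {S P : Set (Space d)} (hPS : P = convexHull ℝ S)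
    {n g : Space d} {h c : ℝ} (hn : ∀ x ∈ P, inner ℝ n x ≤ h)
    (hg : ∀ s ∈ S, inner ℝ n s = h → inner ℝ g s ≤ c) {x : Space d} (hx : x ∈ P)
    (hxn : inner ℝ n x = h) : inner ℝ g x ≤ c := by
  have hconv : Convex ℝ {x : Space d | inner ℝ n x < h ∨ (inner ℝ n x = h ∧ inner ℝ g x ≤ c)} := by
    intro x hx y hy α β hα hβ hαβ
    simp only [Set.mem_ofPred_eq, inner_add_right, real_inner_smul_right] at hx hy ⊢
    have e0 : α * h + β * h = h := by rw [← add_mul, hαβ, one_mul]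
    have e1 : α * c + β * c = c := by rw [← add_mul, hαβ, one_mul]
    rcases hα.eq_or_lt with rfl | hα
    · obtain rfl : β = 1 := by linarith
      simpa using hy
    rcases hβ.eq_or_lt with rfl | hβ
    · obtain rfl : α = 1 := by linarith
      simpa using hx
    rcases hx with hx | ⟨hx1, hx2⟩ <;> rcases hy with hy | ⟨hy1, hy2⟩
    · left
      have := mul_lt_mul_of_pos_left hx hα
      have := mul_lt_mul_of_pos_left hy hβ
      linarith
    · left
      have := mul_lt_mul_of_pos_left hx hα
      rw [hy1]
      linarith
    · left
      have := mul_lt_mul_of_pos_left hy hβ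
      rw [hx1]
      linarith
    · right
      rw [hx1, hy1]
      have := mul_le_mul_of_nonneg_left hx2 hα.le
      have := mul_le_mul_of_nonneg_left hy2 hβ.le
      exact ⟨e0, by linarith⟩
  have hsub : P ⊆ {x : Space d | inner ℝ n x < h ∨ (inner ℝ n x = h ∧ inner ℝ g x ≤ c)} := by
    rw [hPS]
    refine convexHull_min (fun s hs => ?_) hconv
    rcases (hn s (hPS ▸ subset_convexHull ℝ S hs)).lt_or_eq with h1 | h1
    · exact Or.inl h1
    · exact Or.inr ⟨h1, hg s hs h1⟩
  rcases hsub hx with h1 | h1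
  · exact absurd hxn h1.ne
  · exact h1.2

/-- Rotating a supporting line of the face in direction `n` about its vertex `x`, from the line
with inner normal `f` towards that with normal `g`, until it meets a second point. -/
lemma exists_rotation {d : ℕ} {S P F : Set (Space d)} (hS : S.Finite) (hPS : P = convexHull ℝ S)
    {n : Space d} {h : ℝ} (hn : ∀ x ∈ P, inner ℝ n x ≤ h)
    (hF : ∀ x, x ∈ F ↔ x ∈ P ∧ inner ℝ n x = h) {x z₀ f : Space d} (g : Space d)
    (hf : ∀ z ∈ F, z ≠ x → 0 < inner ℝ f (z - x)) (hz₀ : z₀ ∈ F) (hz₀x : z₀ ≠ x) :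
    ∃ t : ℝ, ∃ s ∈ F, s ≠ x ∧ inner ℝ (g - t • f) (s - x) = 0 ∧
      ∀ z ∈ F, 0 ≤ inner ℝ (g - t • f) (z - x) := by
  have hSP : S ⊆ P := hPS ▸ subset_convexHull ℝ S
  have hfin : {s | s ∈ S ∧ s ∈ F ∧ s ≠ x}.Finite := hS.subset fun s hs => hs.1
  have hne : {s | s ∈ S ∧ s ∈ F ∧ s ≠ x}.Nonempty := by
    by_contra hcon
    have : inner ℝ f z₀ ≤ inner ℝ f x :=
      face_inner_le hPS hn (fun s hs hsn => by
        by_cases hsx : s = x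
        · rw [hsx]
        · exact absurd ⟨s, hs, (hF s).2 ⟨hSP hs, hsn⟩, hsx⟩ hcon) ((hF _).1 hz₀).1 ((hF _).1 hz₀).2
    have h2 := hf z₀ hz₀ hz₀x
    rw [inner_sub_right] at h2
    linarith
  -- The rotation stops at the least slope `g / f`, seen from `x`, over the generators on `F` other
  -- than `x`.
  obtain ⟨s, ⟨hsS, hsF, hsx⟩, hmin⟩ :=
    Set.exists_min_image _ (fun s => inner ℝ g (s - x) / inner ℝ f (s - x)) hfin hne
  have hfs := hf s hsF hsx
  refine ⟨inner ℝ g (s - x) / inner ℝ f (s - x), s, hsF, hsx, ?_, fun z hz => ?_⟩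
  · rw [inner_sub_left, real_inner_smul_left, div_mul_cancel₀ _ hfs.ne', sub_self]
  · set t := inner ℝ g (s - x) / inner ℝ f (s - x)
    have key : inner ℝ (-(g - t • f)) z ≤ inner ℝ (-(g - t • f)) x := by
      refine face_inner_le hPS hn (fun s' hs' hs'n => ?_) ((hF _).1 hz).1 ((hF _).1 hz).2
      by_cases hsx' : s' = x
      · rw [hsx']
      · have hs'F := (hF s').2 ⟨hSP hs', hs'n⟩
        have h1 := hmin s' ⟨hs', hs'F, hsx'⟩
        have h2 := hf s' hs'F hsx'
        have h3 : t * inner ℝ f (s' - x) ≤ inner ℝ g (s' - x) := (le_div_iff₀ h2).1 h1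
        simp only [inner_neg_left, inner_sub_left, inner_sub_right, real_inner_smul_left] at h3 ⊢
        linarith
    simp only [inner_neg_left, inner_sub_right] at key ⊢
    linarith

/-- If a linear functional that is not constant on a facet of a three-dimensional polytope attains
its maximum over the facet at two points, then its maximizers form an edge. -/
lemma isEdge_of_isMax {S P F : Set (Space 3)} (hS : S.Finite) (hPS : P = convexHull ℝ S)
    (hF : IsFacet P F) {u x y z₀ : Space 3} (hx : x ∈ F) (hy : y ∈ F) (hxy : y ≠ x)
    (hmax : ∀ z ∈ F, inner ℝ u z ≤ inner ℝ u x) (hyx : inner ℝ u y = inner ℝ u x)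
    (hz₀ : z₀ ∈ F) (hz₀x : inner ℝ u z₀ ≠ inner ℝ u x) :
    IsEdge P {z | z ∈ F ∧ inner ℝ u z = inner ℝ u x} := by
  have hPc : IsCompact P := hPS ▸ hS.isCompact_convexHull ℝ
  obtain ⟨⟨n, hn0, hnF⟩, hdim⟩ := hF
  obtain ⟨hxP, hnle, hmem⟩ := face_facts hPc hnF hx
  refine ⟨?_, ?_⟩
  · obtain ⟨ε, hε, hε0⟩ := ((eventually_perturb hS hPS u hnle (M := inner ℝ u x)
      (fun z hz hzn => hmax z ((hmem z).2 ⟨hz, hzn⟩))).and self_mem_nhdsWithin).exists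
    have hε0 : 0 < ε := hε0
    have hval : inner ℝ (n + ε • u) x = inner ℝ n x + ε * inner ℝ u x := by
      rw [inner_add_left, real_inner_smul_left]
    refine ⟨n + ε • u, fun h0 => hz₀x ?_, ?_⟩
    · have h1 : inner ℝ (n + ε • u) z₀ = inner ℝ (n + ε • u) x := by rw [h0]; simp
      rw [hval, inner_add_left, real_inner_smul_left, ((hmem z₀).1 hz₀).2] at h1
      exact mul_left_cancel₀ hε0.ne' (add_left_cancel h1)
    · rw [supportingHyperplane_inter_eq hxP]
      · ext z
        simp only [Set.mem_ofPred_eq]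
        constructor
        · rintro ⟨hzP, hz⟩
          rcases hε z hzP with h1 | ⟨h1, h2⟩
          · rw [hz, hval] at h1
            exact absurd h1 (lt_irrefl _)
          · exact ⟨(hmem z).2 ⟨hzP, h1⟩, h2⟩
        · rintro ⟨hzF, hz⟩
          refine ⟨((hmem z).1 hzF).1, ?_⟩
          rw [hval, inner_add_left, real_inner_smul_left, ((hmem z).1 hzF).2, hz]
      · intro z hz
        rw [hval]
        rcases hε z hz with h1 | ⟨h1, h2⟩
        · exact h1.le
        · rw [inner_add_left, real_inner_smul_left, h1, h2]
  · unfold affineDim at hdim ⊢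
    rw [direction_affineSpan] at hdim ⊢
    set E := {z | z ∈ F ∧ inner ℝ u z = inner ℝ u x}
    have hEF : vectorSpan ℝ E ≤ vectorSpan ℝ F := vectorSpan_mono ℝ fun z hz => hz.1
    have hEu : vectorSpan ℝ E ≤ (innerₛₗ ℝ u).ker := by
      rw [vectorSpan_def, Submodule.span_le]
      rintro _ ⟨z, hz, z', hz', rfl⟩
      simp [inner_sub_right, hz.2, hz'.2]
    -- The span of `F` has dimension two; that of `E` is strictly smaller and contains `y - x ≠ 0`.
    have hlt : vectorSpan ℝ E < vectorSpan ℝ F := by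
      refine lt_of_le_of_ne hEF fun heq => hz₀x ?_
      have h1 : z₀ -ᵥ x ∈ vectorSpan ℝ E := heq ▸ vsub_mem_vectorSpan ℝ hz₀ hx
      have h2 := hEu h1
      simpa [inner_sub_right, sub_eq_zero] using h2
    have h1 := Submodule.finrank_lt_finrank_of_lt hlt
    have h2 : 0 < Module.finrank ℝ (vectorSpan ℝ E) := by
      rw [Module.finrank_pos_iff_exists_ne_zero]
      refine ⟨⟨y -ᵥ x, vsub_mem_vectorSpan ℝ ⟨hy, hyx⟩ ⟨hx, rfl⟩⟩, ?_⟩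
      simpa [Subtype.ext_iff, sub_eq_zero] using hxy
    omega

/-- The points `z - x`, for `z` in a facet, are not all multiples of one vector. -/
lemma exists_notMem_span {P F : Set (Space 3)} (hF : IsFacet P F) {x : Space 3} (hx : x ∈ F)
    (b : Space 3) : ∃ z ∈ F, z - x ∉ Submodule.span ℝ {b} := by
  by_contra! hcon
  have h1 : vectorSpan ℝ F ≤ Submodule.span ℝ {b} := by
    rw [vectorSpan_eq_span_vsub_set_right ℝ hx, Submodule.span_le]
    rintro _ ⟨z, hz, rfl⟩
    exact hcon z hz
  have h2 := Submodule.finrank_mono h1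
  have h3 : Module.finrank ℝ (Submodule.span ℝ {b}) ≤ 1 := by
    simpa using finrank_span_le_card (R := ℝ) ({b} : Set (Space 3))
  have h4 := hF.2
  unfold affineDim at h4
  rw [direction_affineSpan] at h4
  omega

/-- A linear functional attains its maximum over a facet on some edge of that facet. -/
lemma exists_edge_isMax {S P F : Set (Space 3)} (hS : S.Finite) (hPS : P = convexHull ℝ S)
    (hF : IsFacet P F) {u x z₀ : Space 3} (hx : x ∈ F) (hz₀ : z₀ ∈ F)
    (hne : inner ℝ u z₀ ≠ inner ℝ u x) :
    ∃ e, IsEdge P e ∧ e ⊆ F ∧ ∃ y ∈ e, inner ℝ u x ≤ inner ℝ u y := by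
  have hPc : IsCompact P := hPS ▸ hS.isCompact_convexHull ℝ
  obtain ⟨⟨n, hn0, hnF⟩, hdim⟩ := id hF
  obtain ⟨hxP, hnle, hmem⟩ := face_facts hPc hnF hx
  have hFc : IsCompact F := by
    rw [← hnF]
    refine hPc.inter_left ?_
    exact isClosed_eq (by fun_prop) continuous_const
  obtain ⟨y, hy, hmax⟩ := hFc.exists_isMaxOn ⟨x, hx⟩
    (show ContinuousOn (fun z => inner ℝ u z) F by fun_prop)
  have hmax : ∀ z ∈ F, inner ℝ u z ≤ inner ℝ u y := fun z hz => hmax hz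
  obtain ⟨z₁, hz₁, hz₁y⟩ : ∃ z ∈ F, inner ℝ u z ≠ inner ℝ u y := by
    by_cases h : inner ℝ u z₀ = inner ℝ u y
    · exact ⟨x, hx, fun h' => hne (h.trans h'.symm)⟩
    · exact ⟨z₀, hz₀, h⟩
  by_cases hy' : ∃ y' ∈ F, y' ≠ y ∧ inner ℝ u y' = inner ℝ u y
  · obtain ⟨y', hy'F, hy'y, he⟩ := hy'
    exact ⟨_, isEdge_of_isMax hS hPS hF hy hy'F hy'y hmax he hz₁ hz₁y, fun z hz => hz.1,
      y, ⟨hy, rfl⟩, hmax x hx⟩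
  -- The maximizer `y` is unique, so `-u` exposes it and a supporting line can be rotated about `y`
  -- until it contains an edge.
  · push Not at hy'
    have hf : ∀ z ∈ F, z ≠ y → 0 < inner ℝ (-u) (z - y) := fun z hz hzy => by
      have := lt_of_le_of_ne (hmax z hz) (hy' z hz hzy)
      rw [inner_neg_left, inner_sub_right]
      linarith
    have hz₁' : z₁ ≠ y := fun h => hz₁y (by rw [h])
    obtain ⟨z₂, hz₂, hz₂s⟩ := exists_notMem_span hF hy (z₁ - y)
    -- This choice keeps every `g - t • -u` from vanishing identically on `F - y`: at `z₁` that
    -- would force `t = 0`, and then `z₂` contradicts it.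
    obtain ⟨g, hg, hg2⟩ : ∃ g ∈ (Submodule.span ℝ {z₁ - y})ᗮ, inner ℝ g (z₂ - y) ≠ 0 := by
      by_contra! hcon
      rw [← Submodule.orthogonal_orthogonal (Submodule.span ℝ {z₁ - y}),
        Submodule.mem_orthogonal] at hz₂s
      exact hz₂s hcon
    have hg1 : inner ℝ g (z₁ - y) = 0 := by
      rw [real_inner_comm]
      exact Submodule.mem_orthogonal_singleton_iff_inner_right.1 hg
    obtain ⟨hyP, hnle', hmem'⟩ := face_facts hPc hnF hy
    obtain ⟨t, s, hsF, hsy, hs0, hs⟩ := exists_rotation hS hPS hnle' hmem' g hf hz₁ hz₁'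
    obtain ⟨z₃, hz₃, hz₃0⟩ : ∃ z ∈ F, inner ℝ (g - t • -u) (z - y) ≠ 0 := by
      by_contra! hcon
      have h1 := hcon z₁ hz₁
      have h2 := hcon z₂ hz₂
      rw [inner_sub_left, real_inner_smul_left] at h1 h2
      rw [hg1, zero_sub, neg_eq_zero, mul_eq_zero] at h1
      have ht := h1.resolve_right (hf z₁ hz₁ hz₁').ne'
      rw [ht, zero_mul, sub_zero] at h2
      exact hg2 h2
    refine ⟨_, isEdge_of_isMax (u := -(g - t • -u)) (x := y) hS hPS hF hy hsF hsy
      (fun z hz => ?_) ?_ hz₃ ?_, fun z hz => hz.1, y, ⟨hy, rfl⟩, hmax x hx⟩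
    · have := hs z hz
      rw [inner_sub_right] at this
      rw [inner_neg_left, inner_neg_left]
      linarith
    · rw [inner_sub_right] at hs0
      rw [inner_neg_left, inner_neg_left]
      linarith
    · rw [inner_sub_right, sub_ne_zero] at hz₃0
      rwa [inner_neg_left, inner_neg_left, ne_eq, neg_inj]

/-- If a linear functional takes a value on the facet `G` that is smaller than at its vertex `v`,
then it does so on an edge of `G` at `v`, or it is a negative multiple of a functional `f` that
exposes `v`. -/
lemma exists_edge_neg {S P G : Set (Space 3)} (hS : S.Finite) (hPS : P = convexHull ℝ S)
    (hG : IsFacet P G) {v f u z : Space 3} (hv : v ∈ G)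
    (hf : ∀ z ∈ G, z ≠ v → 0 < inner ℝ f (z - v)) (hz : z ∈ G) (hzu : inner ℝ u (z - v) < 0) :
    (∃ e, IsEdge P e ∧ e ⊆ G ∧ v ∈ e ∧ ∃ y ∈ e, inner ℝ u (y - v) < 0) ∨
      ∃ t : ℝ, t < 0 ∧ ∀ y ∈ G, inner ℝ u (y - v) = t * inner ℝ f (y - v) := by
  have hPc : IsCompact P := hPS ▸ hS.isCompact_convexHull ℝ
  obtain ⟨⟨n, hn0, hnF⟩, hdim⟩ := id hG
  obtain ⟨hvP, hnle, hmem⟩ := face_facts hPc hnF hv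
  have hzv : z ≠ v := by
    rintro rfl
    simp at hzu
  obtain ⟨t, s, hsF, hsv, hs0, hs⟩ := exists_rotation hS hPS hnle hmem u hf hz hzv
  have ht : t < 0 := by
    have h1 := hs z hz
    rw [inner_sub_left, real_inner_smul_left] at h1
    have h2 := hf z hz hzv
    by_contra! h3
    nlinarith
  -- If `u - t f` is not identically zero on `G - v`, its zero set there gives an edge at `v`, on
  -- which `u = t f` is negative away from `v`.
  by_cases hc : ∀ y ∈ G, inner ℝ (u - t • f) (y - v) = 0
  · right
    refine ⟨t, ht, fun y hy => ?_⟩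
    have := hc y hy
    rw [inner_sub_left, real_inner_smul_left] at this
    linarith
  · left
    push Not at hc
    obtain ⟨z₃, hz₃, hz₃0⟩ := hc
    refine ⟨_, isEdge_of_isMax (u := -(u - t • f)) (x := v) hS hPS hG hv hsF hsv
      (fun z hz => ?_) ?_ hz₃ ?_, fun z hz => hz.1, ⟨hv, rfl⟩, s, ⟨hsF, ?_⟩, ?_⟩
    · have := hs z hz
      rw [inner_sub_right] at this
      rw [inner_neg_left, inner_neg_left]
      linarith
    · rw [inner_sub_right] at hs0
      rw [inner_neg_left, inner_neg_left]
      linarith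
    · rw [inner_sub_right, sub_ne_zero] at hz₃0
      rwa [inner_neg_left, inner_neg_left, ne_eq, neg_inj]
    · rw [inner_sub_right] at hs0
      rw [inner_neg_left, inner_neg_left]
      linarith
    · rw [inner_sub_left, real_inner_smul_left] at hs0
      have := hf s hsF hsv
      nlinarith


/-! ### Angle as the volume of separating directions. -/

/-- The vectors of the unit ball on which `x` and `y` have opposite signs. -/
def signSplit (x y : Space 3) : Set (Space 3) :=
  {u | ‖u‖ < 1 ∧ inner ℝ x u * inner ℝ y u < 0}

/-- The volume of `signSplit x y`, which is proportional to the angle between `x` and `y`. -/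
noncomputable def splitVol (x y : Space 3) : ℝ := volume.real (signSplit x y)

lemma signSplit_subset_ball (x y : Space 3) : signSplit x y ⊆ Metric.ball 0 1 := fun u hu => by
  simpa using hu.1

lemma volume_signSplit_ne_top (x y : Space 3) : volume (signSplit x y) ≠ ⊤ :=
  ((measure_mono (signSplit_subset_ball x y)).trans_lt measure_ball_lt_top).ne

lemma isOpen_signSplit (x y : Space 3) : IsOpen (signSplit x y) :=
  (isOpen_lt (f := fun u : Space 3 => ‖u‖) (g := fun _ => 1) (by fun_prop) (by fun_prop)).inter
    (isOpen_lt (f := fun u : Space 3 => inner ℝ x u * inner ℝ y u) (g := fun _ => 0) (by fun_prop)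
      (by fun_prop))

lemma signSplit_comm (x y : Space 3) : signSplit x y = signSplit y x := by
  ext u
  simp [signSplit, mul_comm]

lemma signSplit_smul_left {c : ℝ} (hc : 0 < c) (x y : Space 3) :
    signSplit (c • x) y = signSplit x y := by
  ext u
  simp only [signSplit, Set.mem_ofPred_eq, real_inner_smul_left, mul_assoc]
  rw [← neg_pos, ← mul_neg, mul_pos_iff_of_pos_left hc, neg_pos]

lemma splitVol_smul_smul {c c' : ℝ} (hc : 0 < c) (hc' : 0 < c') (x y : Space 3) :
    splitVol (c • x) (c' • y) = splitVol x y := by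
  rw [splitVol, signSplit_smul_left hc, signSplit_comm, signSplit_smul_left hc', signSplit_comm,
    splitVol]

lemma ae_inner_ne_zero {x : Space 3} (hx : x ≠ 0) : ∀ᵐ u : Space 3, inner ℝ x u ≠ 0 := by
  have h := Measure.addHaar_submodule (volume : Measure (Space 3)) (innerₛₗ ℝ x).ker (by
    rw [Ne, LinearMap.ker_eq_top]
    intro h
    have := congrArg (fun f => f x) h
    simp [hx] at this)
  rw [ae_iff]
  convert h using 2
  ext u
  simp

/-- A plane separating `x` from `z` and missing `y` separates `y` from one of them; the planes
through `y` form a null set. -/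
lemma splitVol_triangle {y : Space 3} (hy : y ≠ 0) (x z : Space 3) :
    splitVol x z ≤ splitVol x y + splitVol y z := by
  have h1 : signSplit x z ≤ᵐ[volume] (signSplit x y ∪ signSplit y z : Set (Space 3)) := by
    filter_upwards [ae_inner_ne_zero hy] with u hu hxz
    obtain ⟨h1, h2⟩ : ‖u‖ < 1 ∧ inner ℝ x u * inner ℝ z u < 0 := hxz
    change (‖u‖ < 1 ∧ _) ∨ (‖u‖ < 1 ∧ _)
    simp only [h1, true_and]
    by_contra! hcon
    have h3 := mul_nonneg hcon.1 hcon.2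
    have h4 : 0 < inner ℝ y u * inner ℝ y u := mul_self_pos.2 hu
    nlinarith
  have h2 : splitVol x z ≤ volume.real (signSplit x y ∪ signSplit y z) :=
    ENNReal.toReal_mono
      ((measure_union_lt_top (volume_signSplit_ne_top _ _).lt_top
        (volume_signSplit_ne_top _ _).lt_top).ne) (measure_mono_ae h1)
  exact h2.trans (measureReal_union_le _ _)

/-- A vector in the cone of `b` and `b'` splits the angle between them. -/
lemma splitVol_add_le {b b' q : Space 3} {α β : ℝ} (hα : 0 ≤ α) (hβ : 0 ≤ β)
    (hq : q = α • b + β • b') : splitVol b q + splitVol q b' ≤ splitVol b b' := by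
  have hval : ∀ u : Space 3, inner ℝ q u = α * inner ℝ b u + β * inner ℝ b' u := fun u => by
    rw [hq, inner_add_left, real_inner_smul_left, real_inner_smul_left]
  -- As `q` lies between `b` and `b'`, no plane cuts it off from both, and a plane cutting it off
  -- from one separates `b` from `b'`.
  have hdisj : Disjoint (signSplit b q) (signSplit q b') := by
    rw [Set.disjoint_left]
    rintro u ⟨-, h1⟩ ⟨-, h2⟩
    rw [hval] at h1 h2
    rcases lt_trichotomy (inner ℝ b u) 0 with h | h | h
    · have h3 : 0 < α * inner ℝ b u + β * inner ℝ b' u := by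
        by_contra! h4
        nlinarith
      have h5 : inner ℝ b' u < 0 := by
        by_contra! h4
        nlinarith
      have := mul_nonneg hα (neg_nonneg.2 h.le)
      have := mul_nonneg hβ (neg_nonneg.2 h5.le)
      linarith
    · simp [h] at h1
    · have h3 : α * inner ℝ b u + β * inner ℝ b' u < 0 := by
        by_contra! h4
        nlinarith
      have h5 : 0 < inner ℝ b' u := by
        by_contra! h4
        nlinarith
      have := mul_nonneg hα h.le
      have := mul_nonneg hβ h5.le
      linarith
  rw [splitVol, splitVol, ← measureReal_union hdisj (isOpen_signSplit _ _).measurableSet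
    (volume_signSplit_ne_top _ _) (volume_signSplit_ne_top _ _)]
  refine measureReal_mono ?_ (volume_signSplit_ne_top _ _)
  rintro u (⟨h0, h1⟩ | ⟨h0, h1⟩) <;> refine ⟨h0, ?_⟩ <;> rw [hval] at h1 <;> by_contra! h2
  · have := mul_nonneg hα (mul_self_nonneg (inner ℝ b u : ℝ))
    have := mul_nonneg hβ h2
    nlinarith
  · have := mul_nonneg hβ (mul_self_nonneg (inner ℝ b' u : ℝ))
    have := mul_nonneg hα h2
    nlinarith

lemma splitVol_map (L : Space 3 ≃ₗᵢ[ℝ] Space 3) (x y : Space 3) :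
    splitVol (L x) (L y) = splitVol x y := by
  have h := L.measurePreserving.measureReal_preimage
    (isOpen_signSplit (L x) (L y)).measurableSet.nullMeasurableSet
  rw [splitVol, ← h, splitVol]
  congr 1
  ext u
  simp [signSplit]

/-! ### The separating volume as a monotone, subadditive function of the angle. -/

/-- The point at angle `t` on the unit circle in the plane of `x` and `f`. -/
noncomputable def circlePt (x f : Space 3) (t : ℝ) : Space 3 := Real.cos t • x + Real.sin t • f

/-- The value of `splitVol` on unit vectors at angle `t`. -/
noncomputable def splitAngle (t : ℝ) : ℝ :=
  splitVol (EuclideanSpace.single 0 1)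
    (circlePt (EuclideanSpace.single 0 1) (EuclideanSpace.single 1 1) t)

lemma exists_isometry {x f : Space 3} (hx : ‖x‖ = 1) (hf : ‖f‖ = 1) (hxf : inner ℝ x f = 0) :
    ∃ L : Space 3 ≃ₗᵢ[ℝ] Space 3,
      L (EuclideanSpace.single 0 1) = x ∧ L (EuclideanSpace.single 1 1) = f := by
  have ho : Orthonormal ℝ (Set.domRestrict {0, 1} (![x, f, 0] : Fin 3 → Space 3)) := by
    rw [orthonormal_iff_ite]
    rintro ⟨i, hi⟩ ⟨j, hj⟩
    rcases hi with rfl | rfl <;> rcases hj with rfl | rfl <;>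
      simp [Set.domRestrict, hx, hf, hxf, real_inner_comm] <;>
      exact fun h => absurd (congrArg Subtype.val h) (by decide)
  obtain ⟨B, hB⟩ := ho.exists_orthonormalBasis_extension_of_card_eq (by simp)
  refine ⟨(EuclideanSpace.basisFun (Fin 3) ℝ).equiv B (Equiv.refl _), ?_, ?_⟩
  · have h := (EuclideanSpace.basisFun (Fin 3) ℝ).equiv_apply_basis B (Equiv.refl _) 0
    simpa [hB 0 (by simp)] using h
  · have h := (EuclideanSpace.basisFun (Fin 3) ℝ).equiv_apply_basis B (Equiv.refl _) 1
    simpa [hB 1 (by simp)] using h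

lemma splitVol_circlePt {x f : Space 3} (hx : ‖x‖ = 1) (hf : ‖f‖ = 1) (hxf : inner ℝ x f = 0)
    (t : ℝ) : splitVol x (circlePt x f t) = splitAngle t := by
  obtain ⟨L, rfl, rfl⟩ := exists_isometry hx hf hxf
  rw [splitAngle, ← splitVol_map L (EuclideanSpace.single 0 1)]
  simp [circlePt]

lemma norm_circlePt {x f : Space 3} (hx : ‖x‖ = 1) (hf : ‖f‖ = 1) (hxf : inner ℝ x f = 0)
    (t : ℝ) : ‖circlePt x f t‖ = 1 := by
  have h : ‖circlePt x f t‖ ^ 2 = 1 := by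
    rw [circlePt, norm_add_sq_real, norm_smul, norm_smul, real_inner_smul_left,
      real_inner_smul_right, hx, hf, hxf, Real.norm_eq_abs, Real.norm_eq_abs, mul_one, mul_one,
      sq_abs, sq_abs]
    linarith [Real.sin_sq_add_cos_sq t]
  nlinarith [norm_nonneg (circlePt x f t)]

/-- This is the triangle inequality for the points at angles `0`, `s`, `s + t`; the last step is
measured in the orthonormal frame rotated by `s`. -/
lemma splitAngle_add_le (s t : ℝ) : splitAngle (s + t) ≤ splitAngle s + splitAngle t := by
  have h0 : ‖(EuclideanSpace.single 0 1 : Space 3)‖ = 1 := by simp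
  have h1 : ‖(EuclideanSpace.single 1 1 : Space 3)‖ = 1 := by simp
  have h01 : inner ℝ (EuclideanSpace.single 0 1 : Space 3) (EuclideanSpace.single 1 1) = 0 := by
    simp [EuclideanSpace.inner_single_left]
  set x : Space 3 := EuclideanSpace.single 0 1
  set f : Space 3 := EuclideanSpace.single 1 1
  have hn := norm_circlePt h0 h1 h01
  have hne : circlePt x f s ≠ 0 := fun h => by simpa [h] using hn s
  have hperp : inner ℝ (circlePt x f s) (circlePt x f (s + Real.pi / 2)) = 0 := by
    simp only [circlePt, inner_add_left, inner_add_right, real_inner_smul_left,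
      real_inner_smul_right, real_inner_self_eq_norm_sq, h0, h1, h01, real_inner_comm x f,
      Real.cos_add_pi_div_two, Real.sin_add_pi_div_two]
    ring
  have hrot : circlePt (circlePt x f s) (circlePt x f (s + Real.pi / 2)) t
      = circlePt x f (s + t) := by
    simp only [circlePt, Real.cos_add_pi_div_two, Real.sin_add_pi_div_two]
    rw [Real.cos_add, Real.sin_add]
    module
  have h2 := splitVol_circlePt (hn s) (hn _) hperp t
  rw [hrot] at h2
  rw [← h2]
  exact splitVol_triangle hne _ _

lemma splitAngle_mono {r t : ℝ} (hr : 0 ≤ r) (hrt : r ≤ t) (ht : t ≤ Real.pi) :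
    splitAngle r ≤ splitAngle t := by
  refine measureReal_mono ?_ (volume_signSplit_ne_top _ _)
  rintro u ⟨h0, h1⟩
  refine ⟨h0, ?_⟩
  set x : Space 3 := EuclideanSpace.single 0 1
  set f : Space 3 := EuclideanSpace.single 1 1
  have hx : inner ℝ x u ≠ 0 := fun h => by simp [h] at h1
  have hx2 : 0 < inner ℝ x u * inner ℝ x u := mul_self_pos.2 hx
  rcases ht.eq_or_lt with rfl | ht
  · simp only [circlePt, Real.cos_pi, Real.sin_pi, inner_add_left, real_inner_smul_left]
    linarith
  · have hs1 : 0 ≤ Real.sin r := Real.sin_nonneg_of_nonneg_of_le_pi hr (by linarith)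
    have hs2 : 0 ≤ Real.sin (t - r) :=
      Real.sin_nonneg_of_nonneg_of_le_pi (by linarith) (by linarith)
    have hs3 : 0 ≤ Real.sin t := Real.sin_nonneg_of_nonneg_of_le_pi (by linarith) ht.le
    -- The point at angle `r` lies in the cone of those at angles `0` and `t`, so a plane separating
    -- it from `x` also separates the point at `t` from `x`.
    have key : Real.sin t * inner ℝ (circlePt x f r) u =
        Real.sin (t - r) * inner ℝ x u + Real.sin r * inner ℝ (circlePt x f t) u := by
      simp only [circlePt, inner_add_left, real_inner_smul_left, Real.sin_sub]
      ring
    by_contra! h2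
    rcases hs3.eq_or_lt with h3 | h3
    · have : t = 0 := by
        by_contra hne
        exact (Real.sin_pos_of_pos_of_lt_pi (lt_of_le_of_ne (by linarith) (Ne.symm hne)) ht).ne h3
      obtain rfl : r = 0 := by linarith
      rw [this] at h2
      linarith
    · have e1 := mul_neg_of_pos_of_neg h3 h1
      have e2 := mul_nonneg hs2 hx2.le
      have e3 := mul_nonneg hs1 h2
      have e4 : Real.sin t * (inner ℝ x u * inner ℝ (circlePt x f r) u) =
          inner ℝ x u * (Real.sin t * inner ℝ (circlePt x f r) u) := by ring
      rw [e4, key] at e1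
      linarith

/-- Monotonicity is available only up to `π`. If `s + t > π`, split `π` as `s + (π - s)` and use `π
- s ≤ t`. -/
lemma splitAngle_le_add {r s t : ℝ} (hr : 0 ≤ r) (hr' : r ≤ Real.pi)
    (hs' : s ≤ Real.pi) (ht' : t ≤ Real.pi) (h : r ≤ s + t) :
    splitAngle r ≤ splitAngle s + splitAngle t := by
  by_cases hst : s + t ≤ Real.pi
  · exact (splitAngle_mono hr h hst).trans (splitAngle_add_le s t)
  · push Not at hst
    have h1 := splitAngle_mono hr hr' le_rfl
    have h2 := splitAngle_add_le s (Real.pi - s)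
    have h3 := splitAngle_mono (r := Real.pi - s) (t := t) (by linarith) (by linarith) ht'
    rw [add_sub_cancel] at h2
    linarith

lemma exists_unit_orthogonal (x : Space 3) : ∃ f : Space 3, ‖f‖ = 1 ∧ inner ℝ x f = 0 := by
  have : (Submodule.span ℝ {x})ᗮ ≠ ⊥ := by
    intro h
    have h1 := Submodule.finrank_add_finrank_orthogonal (Submodule.span ℝ {x})
    have h2 : Module.finrank ℝ (Submodule.span ℝ {x}) ≤ 1 := by
      simpa using finrank_span_le_card (R := ℝ) ({x} : Set (Space 3))
    rw [h] at h1
    simp at h1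
    omega
  obtain ⟨g, hg, hg0⟩ := Submodule.exists_mem_ne_zero_of_ne_bot this
  refine ⟨‖g‖⁻¹ • g, norm_smul_inv_norm hg0, ?_⟩
  rw [real_inner_smul_right, Submodule.mem_orthogonal_singleton_iff_inner_right.1 hg, mul_zero]

/-- The volume is invariant under positive scaling and isometries, so it depends on the angle alone.
If `sin t = 0`, any unit vector orthogonal to `x` completes the frame. -/
lemma splitVol_eq_splitAngle {x y : Space 3} (hx : x ≠ 0) (hy : y ≠ 0) :
    splitVol x y = splitAngle (InnerProductGeometry.angle x y) := by
  have hx0 := norm_pos_iff.2 hx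
  have hy0 := norm_pos_iff.2 hy
  set t := InnerProductGeometry.angle x y with ht
  have hnx : ‖(‖x‖⁻¹ • x)‖ = 1 := norm_smul_inv_norm hx
  have hny : ‖(‖y‖⁻¹ • y)‖ = 1 := norm_smul_inv_norm hy
  have hcos : inner ℝ (‖x‖⁻¹ • x) (‖y‖⁻¹ • y) = Real.cos t := by
    rw [ht, InnerProductGeometry.cos_angle, real_inner_smul_left, real_inner_smul_right]
    field_simp
  rw [← splitVol_smul_smul (inv_pos.2 hx0) (inv_pos.2 hy0)]
  generalize ‖x‖⁻¹ • x = x' at *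
  generalize ‖y‖⁻¹ • y = y' at *
  have hnorm : ‖y' - Real.cos t • x'‖ ^ 2 = Real.sin t ^ 2 := by
    rw [norm_sub_sq_real, real_inner_smul_right, real_inner_comm, hcos, norm_smul, hny, hnx,
      Real.norm_eq_abs, mul_one, sq_abs]
    linarith [Real.sin_sq_add_cos_sq t]
  by_cases hs : Real.sin t = 0
  · obtain ⟨f, hf, hxf⟩ := exists_unit_orthogonal x'
    rw [← splitVol_circlePt hnx hf hxf]
    congr 1
    rw [hs, zero_pow two_ne_zero] at hnorm
    have : y' - Real.cos t • x' = 0 := norm_eq_zero.1 (pow_eq_zero_iff two_ne_zero |>.1 hnorm)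
    rw [circlePt, hs, zero_smul, add_zero]
    exact sub_eq_zero.1 this
  · have hf : ‖(Real.sin t)⁻¹ • (y' - Real.cos t • x')‖ = 1 := by
      have : ‖(Real.sin t)⁻¹ • (y' - Real.cos t • x')‖ ^ 2 = 1 := by
        rw [norm_smul, mul_pow, hnorm, Real.norm_eq_abs, sq_abs]
        field_simp
      nlinarith [norm_nonneg ((Real.sin t)⁻¹ • (y' - Real.cos t • x'))]
    have hxf : inner ℝ x' ((Real.sin t)⁻¹ • (y' - Real.cos t • x')) = 0 := by
      rw [real_inner_smul_right, inner_sub_right, real_inner_smul_right, hcos,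
        real_inner_self_eq_norm_sq, hnx]
      ring
    rw [← splitVol_circlePt hnx hf hxf]
    congr 1
    rw [circlePt, smul_inv_smul₀ hs]
    abel

lemma splitVol_le_add_of_angle_le {x x' e q q' : Space 3} (hx : x ≠ 0) (hx' : x' ≠ 0) (he : e ≠ 0)
    (hq : q ≠ 0) (hq' : q' ≠ 0)
    (h : InnerProductGeometry.angle x' x ≤
      InnerProductGeometry.angle q' e + InnerProductGeometry.angle e q) :
    splitVol x' x ≤ splitVol q' e + splitVol e q := by
  rw [splitVol_eq_splitAngle hx' hx, splitVol_eq_splitAngle hq' he, splitVol_eq_splitAngle he hq]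
  exact splitAngle_le_add (InnerProductGeometry.angle_nonneg _ _)
    (InnerProductGeometry.angle_le_pi _ _)
    (InnerProductGeometry.angle_le_pi _ _) (InnerProductGeometry.angle_le_pi _ _) h

/-! ### The comparison of angles across an edge. -/

/-- The sine of `arccos (p / r)` is at least `s / r`, so the addition formula bounds the cosine by
`(p p' - s s') / (r r')`. -/
lemma cos_add_le_of_inner_le {r r' p p' s s' N : ℝ} (hr : 0 < r) (hr' : 0 < r') (hs : 0 ≤ s)
    (hs' : 0 ≤ s') (h : p ^ 2 + s ^ 2 ≤ r ^ 2) (h' : p' ^ 2 + s' ^ 2 ≤ r' ^ 2)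
    (hN : p * p' - s * s' ≤ N) :
    Real.cos (Real.arccos (p / r) + Real.arccos (p' / r')) ≤ N / (r * r') := by
  have aux : ∀ {r p s : ℝ}, 0 < r → 0 ≤ s → p ^ 2 + s ^ 2 ≤ r ^ 2 →
      Real.cos (Real.arccos (p / r)) = p / r ∧ s / r ≤ Real.sin (Real.arccos (p / r)) := by
    intro r p s hr hs h
    have h1 : |p| ≤ r := abs_le_of_sq_le_sq (by nlinarith) hr.le
    rw [abs_le] at h1
    refine ⟨Real.cos_arccos ?_ ?_, ?_⟩
    · rw [le_div_iff₀ hr]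
      linarith
    · rw [div_le_iff₀ hr]
      linarith
    · rw [Real.sin_arccos]
      apply Real.le_sqrt_of_sq_le
      rw [div_pow, div_pow, le_sub_iff_add_le, ← add_div, div_le_one (by positivity)]
      linarith
  obtain ⟨h1, h2⟩ := aux hr hs h
  obtain ⟨h1', h2'⟩ := aux hr' hs' h'
  rw [Real.cos_add, h1, h1']
  have h3 := mul_le_mul h2 h2' (by positivity)
    (Real.sin_arccos (p / r) ▸ Real.sqrt_nonneg _)
  have h4 : (p * p' - s * s') / (r * r') ≤ N / (r * r') := by gcongr
  have h5 : (p * p' - s * s') / (r * r') = p / r * (p' / r') - s / r * (s' / r') := by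
    field_simp
  linarith

/-- Comparison of angles: `A` and `A'` lie at the same height `D ≥ ω` over a plane containing `e`;
`x`, `q` arise from `A`, and `x'`, `q'` from `A'`, by splitting off orthogonal vectors of
length `ω`. -/
lemma angle_le_angle_add_angle {A A' x x' e q q' c : Space 3} {ω D : ℝ} (he : ‖e‖ = 1)
    (hc : ‖c‖ = 1) (hec : inner ℝ e c = 0) (hω : 0 ≤ ω) (hD : ω ≤ D) (hA : inner ℝ A c = D)
    (hA' : inner ℝ A' c = D) (hx : ‖x‖ ^ 2 = ‖A‖ ^ 2 - ω ^ 2) (hx' : ‖x'‖ ^ 2 = ‖A'‖ ^ 2 - ω ^ 2)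
    (hq : ‖q‖ = ‖x‖) (hq' : ‖q'‖ = ‖x'‖) (hx0 : x ≠ 0) (hx0' : x' ≠ 0)
    (hxx : inner ℝ x' x = inner ℝ A' A - ω ^ 2) (hqe : inner ℝ e q ≤ inner ℝ A e)
    (hqe' : inner ℝ q' e ≤ inner ℝ A' e) :
    InnerProductGeometry.angle x' x ≤
      InnerProductGeometry.angle q' e + InnerProductGeometry.angle e q := by
  have hr := norm_pos_iff.2 hx0
  have hr' := norm_pos_iff.2 hx0'
  have hDω : ω ^ 2 ≤ D ^ 2 := by gcongr
  have hnorm : ∀ B : Space 3, inner ℝ B c = D →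
      ‖B - inner ℝ B e • e - D • c‖ ^ 2 = ‖B‖ ^ 2 - inner ℝ B e ^ 2 - D ^ 2 := by
    intro B hB
    rw [← real_inner_self_eq_norm_sq, ← real_inner_self_eq_norm_sq]
    simp only [inner_sub_left, inner_sub_right, real_inner_smul_left, real_inner_smul_right,
      real_inner_comm B e, real_inner_comm B c, real_inner_comm e c, hec, hB]
    rw [real_inner_self_eq_norm_sq e, real_inner_self_eq_norm_sq c, he, hc]
    ring
  have hAA : inner ℝ (A' - inner ℝ A' e • e - D • c) (A - inner ℝ A e • e - D • c) =
      inner ℝ A' A - inner ℝ A' e * inner ℝ A e - D ^ 2 := by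
    simp only [inner_sub_left, inner_sub_right, real_inner_smul_left, real_inner_smul_right,
      hec, hA']
    rw [real_inner_comm A c, hA, real_inner_comm e c, hec, real_inner_comm A e,
      real_inner_self_eq_norm_sq e, real_inner_self_eq_norm_sq c, he, hc]
    ring
  -- Cauchy–Schwarz for the components orthogonal to `e` and `c`; the `c`-components contribute `D²
  -- - ω² ≥ 0`, which can be dropped.
  have hcs := neg_le_of_abs_le (abs_real_inner_le_norm (A' - inner ℝ A' e • e - D • c)
    (A - inner ℝ A e • e - D • c))
  have h1 := hnorm A hA
  have h2 := hnorm A' hA'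
  have hcos := cos_add_le_of_inner_le (N := inner ℝ x' x) hr' hr (norm_nonneg _) (norm_nonneg _)
    (p := inner ℝ A' e) (p' := inner ℝ A e) (s := ‖A' - inner ℝ A' e • e - D • c‖)
    (s' := ‖A - inner ℝ A e • e - D • c‖) (by linarith) (by linarith) (by linarith)
  rw [← InnerProductGeometry.cos_angle] at hcos
  have hle : Real.arccos (inner ℝ A' e / ‖x'‖) ≤ InnerProductGeometry.angle q' e := by
    unfold InnerProductGeometry.angle
    apply Real.arccos_le_arccos
    rw [hq', he, mul_one]
    gcongr
  have hle' : Real.arccos (inner ℝ A e / ‖x‖) ≤ InnerProductGeometry.angle e q := by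
    unfold InnerProductGeometry.angle
    apply Real.arccos_le_arccos
    rw [hq, he, one_mul]
    gcongr
  -- The sum of the two arccosines may exceed `π`, but then there is nothing to prove; under the
  -- negated claim it is below `π` and cosine is decreasing.
  by_contra! hlt
  have h3 := Real.cos_lt_cos_of_nonneg_of_le_pi
    (add_nonneg (Real.arccos_nonneg (inner ℝ A' e / ‖x'‖)) (Real.arccos_nonneg (inner ℝ A e / ‖x‖)))
    (InnerProductGeometry.angle_le_pi x' x) (by linarith)
  linarith


/-! ### Cyclic indices and blocks. -/

lemma exists_sub_one_of_exists {k : ℕ} [NeZero k] {s : Fin k → Prop} (h1 : ∃ j, s j)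
    (h2 : ∃ j, ¬ s j) : ∃ j, ¬ s (j - 1) ∧ s j := by
  by_contra! hcon
  obtain ⟨j₀, hj₀⟩ := h2
  obtain ⟨j, hj⟩ := h1
  have key : ∀ m : ℕ, ¬ s (j₀ + Fin.ofNat k m) := by
    intro m
    induction m with
    | zero => simpa [Fin.ofNat] using hj₀
    | succ m ih =>
      apply hcon
      have e : j₀ + Fin.ofNat k (m + 1) - 1 = j₀ + Fin.ofNat k m := by
        rw [add_sub_assoc]
        congr 1
        rw [sub_eq_iff_eq_add]
        ext
        simp [Fin.val_add]
      rwa [e]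
  refine key (j - j₀).val ?_
  rwa [Fin.ofNat_val_eq_self, add_sub_cancel]

lemma fin_add_one_ne {k : ℕ} [NeZero k] (hk : 3 ≤ k) (j : Fin k) : j + 1 ≠ j := by
  intro h
  have h1 := congrArg Fin.val (add_eq_left.1 h)
  rw [Fin.val_one', Fin.val_zero, Nat.mod_eq_of_lt (by omega)] at h1
  omega

lemma fin_add_one_add_one_ne {k : ℕ} [NeZero k] (hk : 3 ≤ k) (j : Fin k) : j + 1 + 1 ≠ j := by
  intro h
  rw [add_assoc] at h
  have h1 := congrArg Fin.val (add_eq_left.1 h)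
  rw [Fin.val_add, Fin.val_one', Fin.val_zero, Nat.mod_eq_of_lt (show 1 < k by omega),
    Nat.mod_eq_of_lt (by omega)] at h1
  omega

/-- The cyclic successor on indices that are arranged in blocks. -/
def blockSucc {k : ℕ} [NeZero k] {i : Fin k → ℕ} (hi : ∀ j, 0 < i j)
    (p : (j : Fin k) × Fin (i j)) : (j : Fin k) × Fin (i j) :=
  if h : p.2.val + 1 < i p.1 then ⟨p.1, ⟨p.2.val + 1, h⟩⟩ else ⟨p.1 + 1, ⟨0, hi (p.1 + 1)⟩⟩

lemma blockNext_eq {α : Type*} {k : ℕ} [NeZero k] {i : Fin k → ℕ} (hi : ∀ j, 0 < i j)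
    (w : (j : Fin k) → Fin (i j) → α) (j : Fin k) (l : Fin (i j)) :
    blockNext hi w j l = w (blockSucc hi ⟨j, l⟩).1 (blockSucc hi ⟨j, l⟩).2 := by
  by_cases h : l.val + 1 < i j
  · have e : blockSucc hi ⟨j, l⟩ = ⟨j, ⟨l.val + 1, h⟩⟩ := dif_pos h
    rw [e, blockNext, dif_pos h]
  · have e : blockSucc hi ⟨j, l⟩ = ⟨j + 1, ⟨0, hi (j + 1)⟩⟩ := dif_neg h
    rw [e, blockNext, dif_neg h]

lemma blockSucc_ne {k : ℕ} [NeZero k] {i : Fin k → ℕ} (hi : ∀ j, 0 < i j) (hk : 3 ≤ k)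
    (p : (j : Fin k) × Fin (i j)) : blockSucc hi p ≠ p := by
  obtain ⟨j, l⟩ := p
  unfold blockSucc
  split_ifs with h
  · intro h1
    have := congrArg Fin.val (eq_of_heq (Sigma.mk.inj h1).2)
    simp at this
  · exact fun h1 => fin_add_one_ne hk j (congrArg Sigma.fst h1)

/-- This ensures that an edge at `v` and its next two successors are pairwise distinct, as needed to
exclude coplanar triples. -/
lemma blockSucc_blockSucc_ne {k : ℕ} [NeZero k] {i : Fin k → ℕ} (hi : ∀ j, 0 < i j) (hk : 3 ≤ k)
    (p : (j : Fin k) × Fin (i j)) : blockSucc hi (blockSucc hi p) ≠ p := by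
  obtain ⟨j, l⟩ := p
  by_cases h : l.val + 1 < i j
  · have e1 : blockSucc hi ⟨j, l⟩ = ⟨j, ⟨l.val + 1, h⟩⟩ := dif_pos h
    rw [e1]
    by_cases h' : l.val + 1 + 1 < i j
    · have e2 : blockSucc hi ⟨j, ⟨l.val + 1, h⟩⟩ = ⟨j, ⟨l.val + 1 + 1, h'⟩⟩ := dif_pos h'
      rw [e2]
      intro h1
      have := congrArg Fin.val (eq_of_heq (Sigma.mk.inj h1).2)
      simp at this
      omega
    · have e2 : blockSucc hi ⟨j, ⟨l.val + 1, h⟩⟩ = ⟨j + 1, ⟨0, hi (j + 1)⟩⟩ := dif_neg h'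
      rw [e2]
      exact fun h1 => fin_add_one_ne hk j (congrArg Sigma.fst h1)
  · have e1 : blockSucc hi ⟨j, l⟩ = ⟨j + 1, ⟨0, hi (j + 1)⟩⟩ := dif_neg h
    rw [e1]
    by_cases h' : 0 + 1 < i (j + 1)
    · have e2 : blockSucc hi ⟨j + 1, ⟨0, hi (j + 1)⟩⟩ = ⟨j + 1, ⟨0 + 1, h'⟩⟩ := dif_pos h'
      rw [e2]
      exact fun h1 => fin_add_one_ne hk j (congrArg Sigma.fst h1)
    · have e2 : blockSucc hi ⟨j + 1, ⟨0, hi (j + 1)⟩⟩ = ⟨j + 1 + 1, ⟨0, hi (j + 1 + 1)⟩⟩ :=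
        dif_neg h'
      rw [e2]
      exact fun h1 => fin_add_one_add_one_ne hk j (congrArg Sigma.fst h1)

/-! ### Edges at a vertex are in convex position. -/

/-- Coefficients of a relation between vectors on the positive side of a plane cannot all have one
sign. One of the three is therefore opposed to the other two, and its vector is a nonnegative
combination of theirs. -/
lemma exists_opposite_sign {p q r a b c : ℝ} (ha : 0 < a) (hb : 0 < b) (hc : 0 < c)
    (hsum : p * a + q * b + r * c = 0) (hne : p ≠ 0 ∨ q ≠ 0 ∨ r ≠ 0) :
    (p ≠ 0 ∧ p * q ≤ 0 ∧ p * r ≤ 0) ∨ (q ≠ 0 ∧ q * p ≤ 0 ∧ q * r ≤ 0) ∨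
      (r ≠ 0 ∧ r * p ≤ 0 ∧ r * q ≤ 0) := by
  have aux : ∀ {p q r : ℝ}, p * a + q * b + r * c = 0 → (p ≠ 0 ∨ q ≠ 0 ∨ r ≠ 0) → 0 ≤ p → 0 ≤ q →
      0 ≤ r → False := by
    intro p q r hsum hne hp hq hr
    have h1 := mul_nonneg hp ha.le
    have h2 := mul_nonneg hq hb.le
    have h3 := mul_nonneg hr hc.le
    rcases hne with h | h | h
    · exact h ((mul_eq_zero.1 (by linarith : p * a = 0)).resolve_right ha.ne')
    · exact h ((mul_eq_zero.1 (by linarith : q * b = 0)).resolve_right hb.ne')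
    · exact h ((mul_eq_zero.1 (by linarith : r * c = 0)).resolve_right hc.ne')
  have aux' : p ≤ 0 → q ≤ 0 → r ≤ 0 → False := fun hp hq hr =>
    aux (p := -p) (q := -q) (r := -r) (by linarith) (by simpa using hne) (by linarith)
      (by linarith) (by linarith)
  rcases le_total 0 p with hp | hp <;> rcases le_total 0 q with hq | hq <;>
    rcases le_total 0 r with hr | hr
  · exact (aux hsum hne hp hq hr).elim
  · exact Or.inr (Or.inr ⟨fun h => aux hsum hne hp hq h.ge,
      mul_nonpos_of_nonpos_of_nonneg hr hp, mul_nonpos_of_nonpos_of_nonneg hr hq⟩)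
  · exact Or.inr (Or.inl ⟨fun h => aux hsum hne hp h.ge hr,
      mul_nonpos_of_nonpos_of_nonneg hq hp, mul_nonpos_of_nonpos_of_nonneg hq hr⟩)
  · exact Or.inl ⟨fun h => aux' h.le hq hr,
      mul_nonpos_of_nonneg_of_nonpos hp hq, mul_nonpos_of_nonneg_of_nonpos hp hr⟩
  · exact Or.inl ⟨fun h => aux hsum hne h.ge hq hr,
      mul_nonpos_of_nonpos_of_nonneg hp hq, mul_nonpos_of_nonpos_of_nonneg hp hr⟩
  · exact Or.inr (Or.inl ⟨fun h => aux' hp h.le hr,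
      mul_nonpos_of_nonneg_of_nonpos hq hp, mul_nonpos_of_nonneg_of_nonpos hq hr⟩)
  · exact Or.inr (Or.inr ⟨fun h => aux' hp hq h.le,
      mul_nonpos_of_nonneg_of_nonpos hr hp, mul_nonpos_of_nonneg_of_nonpos hr hq⟩)
  · exact (aux' hp hq hr).elim

/-- Of three vectors in a plane that lie strictly on one side of a line, one is in the cone
spanned by the other two. -/
lemma exists_nonneg_comb {x y z u n : Space 3} (hu : u ≠ 0) (hx : inner ℝ u x = 0)
    (hy : inner ℝ u y = 0) (hz : inner ℝ u z = 0) (hnx : 0 < inner ℝ n x) (hny : 0 < inner ℝ n y)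
    (hnz : 0 < inner ℝ n z) :
    (∃ α β : ℝ, 0 ≤ α ∧ 0 ≤ β ∧ x = α • y + β • z) ∨
    (∃ α β : ℝ, 0 ≤ α ∧ 0 ≤ β ∧ y = α • x + β • z) ∨
    (∃ α β : ℝ, 0 ≤ α ∧ 0 ≤ β ∧ z = α • x + β • y) := by
  have hdep : ¬ LinearIndependent ℝ ![x, y, z] := by
    intro hli
    have h1 := finrank_span_eq_card hli
    have h2 : Submodule.span ℝ (Set.range ![x, y, z]) ≤ (Submodule.span ℝ {u})ᗮ := by
      rw [Submodule.span_le]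
      rintro _ ⟨i, rfl⟩
      rw [SetLike.mem_coe, Submodule.mem_orthogonal_singleton_iff_inner_right]
      fin_cases i <;> simp [hx, hy, hz]
    have h3 := Submodule.finrank_mono h2
    have h4 := Submodule.finrank_add_finrank_orthogonal (Submodule.span ℝ {u})
    rw [finrank_span_singleton hu] at h4
    simp at h1 h4
    omega
  rw [Fintype.not_linearIndependent_iff] at hdep
  obtain ⟨c, hc, hne⟩ := hdep
  have hc' : c 0 • x + c 1 • y + c 2 • z = 0 := by simpa [Fin.sum_univ_three] using hc
  have hne' : c 0 ≠ 0 ∨ c 1 ≠ 0 ∨ c 2 ≠ 0 := by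
    obtain ⟨i, hi⟩ := hne
    fin_cases i
    · exact Or.inl hi
    · exact Or.inr (Or.inl hi)
    · exact Or.inr (Or.inr hi)
  clear hc hne
  generalize c 0 = p at *
  generalize c 1 = q at *
  generalize c 2 = r at *
  have hsum : p * inner ℝ n x + q * inner ℝ n y + r * inner ℝ n z = 0 := by
    have := congrArg (fun t => inner ℝ n t) hc'
    simpa [inner_add_right, real_inner_smul_right] using this
  have aux : ∀ {p q r : ℝ} {x y z : Space 3}, p • x + q • y + r • z = 0 → p ≠ 0 →
      0 ≤ -(p⁻¹ * q) → 0 ≤ -(p⁻¹ * r) →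
      ∃ α β : ℝ, 0 ≤ α ∧ 0 ≤ β ∧ x = α • y + β • z := by
    intro p q r x y z h hp hq hr
    refine ⟨_, _, hq, hr, ?_⟩
    have h1 : p⁻¹ • (p • x + q • y + r • z) = 0 := by rw [h, smul_zero]
    rw [smul_add, smul_add, inv_smul_smul₀ hp, smul_smul, smul_smul, add_assoc] at h1
    rw [eq_neg_of_add_eq_zero_left h1]
    module
  have hy' : q • y + p • x + r • z = 0 := by rw [← hc']; abel
  have hz' : r • z + p • x + q • y = 0 := by rw [← hc']; abel
  have same : ∀ {p q : ℝ}, p ≠ 0 → p * q ≤ 0 → 0 ≤ -(p⁻¹ * q) := by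
    intro p q hp h
    have h1 : p⁻¹ * q = (p⁻¹ * p⁻¹) * (p * q) := by field_simp
    rw [h1, neg_nonneg]
    exact mul_nonpos_of_nonneg_of_nonpos (mul_self_nonneg _) h
  have cases := exists_opposite_sign hnx hny hnz hsum hne'
  rcases cases with ⟨h1, h2, h3⟩ | ⟨h1, h2, h3⟩ | ⟨h1, h2, h3⟩
  · exact Or.inl (aux hc' h1 (same h1 h2) (same h1 h3))
  · exact Or.inr (Or.inl (aux hy' h1 (same h1 h2) (same h1 h3)))
  · exact Or.inr (Or.inr (aux hz' h1 (same h1 h2) (same h1 h3)))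

lemma ne_of_isEdge_segment {P : Set (Space 3)} {v w : Space 3} (h : IsEdge P (segment ℝ v w)) :
    w ≠ v := by
  rintro rfl
  have := h.2
  rw [segment_same, affineDim, direction_affineSpan, vectorSpan_singleton] at this
  simp at this

lemma mem_of_isEdge_segment {P : Set (Space 3)} {v w : Space 3} (h : IsEdge P (segment ℝ v w)) :
    v ∈ P ∧ w ∈ P := by
  obtain ⟨⟨f, -, hf⟩, -⟩ := h
  exact ⟨(hf.symm ▸ left_mem_segment ℝ v w : v ∈ _ ∩ P).2,
    (hf.symm ▸ right_mem_segment ℝ v w : w ∈ _ ∩ P).2⟩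

/-- An edge `vw` is exposed by a functional, which vanishes on `w - v`. -/
lemma exists_normal_of_isEdge {P : Set (Space 3)} (hP : IsCompact P) {v w : Space 3}
    (h : IsEdge P (segment ℝ v w)) :
    ∃ f : Space 3, inner ℝ f (w - v) = 0 ∧ (∀ x ∈ P, inner ℝ f (x - v) ≤ 0) ∧
      ∀ x ∈ P, inner ℝ f (x - v) = 0 → ∃ s : ℝ, 0 ≤ s ∧ x - v = s • (w - v) := by
  obtain ⟨⟨f, -, hf⟩, -⟩ := h
  obtain ⟨-, h1, h2⟩ := face_facts hP hf (left_mem_segment ℝ v w)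
  refine ⟨f, ?_, fun x hx => ?_, fun x hx hx0 => ?_⟩
  · rw [inner_sub_right, ((h2 w).1 (right_mem_segment ℝ v w)).2, sub_self]
  · rw [inner_sub_right]
    linarith [h1 x hx]
  · rw [inner_sub_right, sub_eq_zero] at hx0
    have h3 := (h2 x).2 ⟨hx, hx0⟩
    rw [segment_eq_image'] at h3
    obtain ⟨s, hs, rfl⟩ := h3
    exact ⟨s, hs.1, by simp⟩

/-- A functional exposing one edge vanishes on the other, so each end point lies on the other
segment and the ratio is `1`. -/
lemma eq_of_sub_eq_smul {P : Set (Space 3)} (hP : IsCompact P) {v w w' : Space 3} {t : ℝ}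
    (h : IsEdge P (segment ℝ v w)) (h' : IsEdge P (segment ℝ v w')) (ht : w' - v = t • (w - v))
    (ht0 : 0 ≤ t) : w' = w := by
  have key : ∀ {w w' : Space 3} {t : ℝ}, IsEdge P (segment ℝ v w) → w' ∈ P →
      w' - v = t • (w - v) → t ≤ 1 := by
    intro w w' t h hw' ht
    obtain ⟨⟨f, -, hf⟩, -⟩ := id h
    obtain ⟨-, -, h2⟩ := face_facts hP hf (left_mem_segment ℝ v w)
    have h3 : inner ℝ f (w' - v) = 0 := by
      rw [ht, real_inner_smul_right, inner_sub_right, ((h2 w).1 (right_mem_segment ℝ v w)).2,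
        sub_self, mul_zero]
    rw [inner_sub_right, sub_eq_zero] at h3
    have h4 := (h2 w').2 ⟨hw', h3⟩
    rw [segment_eq_image'] at h4
    obtain ⟨s, hs, rfl⟩ := h4
    have h5 : s • (w - v) = t • (w - v) := by simpa using ht
    have h6 := smul_left_injective ℝ (sub_ne_zero.2 (ne_of_isEdge_segment h)) h5
    exact h6 ▸ hs.2
  have h1 := key h (mem_of_isEdge_segment h').2 ht
  have ht1 : t ≠ 0 := by
    rintro rfl
    rw [zero_smul, sub_eq_zero] at ht
    exact ne_of_isEdge_segment h' ht
  have h2 : w - v = t⁻¹ • (w' - v) := by rw [ht, inv_smul_smul₀ ht1]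
  have h3 := key h' (mem_of_isEdge_segment h).2 h2
  have h4 : t = 1 := by
    have : 0 < t := lt_of_le_of_ne ht0 ht1.symm
    rw [inv_le_one₀ this] at h3
    linarith
  rw [h4, one_smul] at ht
  exact sub_left_injective ht

/-- No edge at `v` lies in the cone spanned by two others. -/
lemma not_comb_of_isEdge {P : Set (Space 3)} (hP : IsCompact P) {v x y z : Space 3}
    (hx : IsEdge P (segment ℝ v x)) (hy : IsEdge P (segment ℝ v y)) (hz : IsEdge P (segment ℝ v z))
    (hxy : x ≠ y) (hzy : z ≠ y) :
    ¬ ∃ α β : ℝ, 0 ≤ α ∧ 0 ≤ β ∧ y - v = α • (x - v) + β • (z - v) := by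
  rintro ⟨α, β, hα, hβ, h⟩
  rcases hα.eq_or_lt with rfl | hα
  · rw [zero_smul, zero_add] at h
    exact hzy (eq_of_sub_eq_smul hP hz hy h hβ).symm
  obtain ⟨f, h1, h2, h3⟩ := exists_normal_of_isEdge hP hy
  have hfx := h2 x (mem_of_isEdge_segment hx).2
  have hfz := h2 z (mem_of_isEdge_segment hz).2
  rw [h, inner_add_right, real_inner_smul_right, real_inner_smul_right] at h1
  have h4 : inner ℝ f (x - v) = 0 := by
    have := mul_nonpos_of_nonneg_of_nonpos hβ hfz
    by_contra hne
    have := mul_neg_of_pos_of_neg hα (lt_of_le_of_ne hfx hne)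
    linarith
  obtain ⟨s, hs, h5⟩ := h3 x (mem_of_isEdge_segment hx).2 h4
  exact hxy (eq_of_sub_eq_smul hP hy hx h5 hs)

/-- Three edges at a vertex are never coplanar. -/
lemma not_coplanar_of_isEdge {P : Set (Space 3)} (hP : IsCompact P) {v x y z g n : Space 3}
    (hn : ∀ x ∈ P, x ≠ v → 0 < inner ℝ n (x - v))
    (hx : IsEdge P (segment ℝ v x)) (hy : IsEdge P (segment ℝ v y)) (hz : IsEdge P (segment ℝ v z))
    (hxy : x ≠ y) (hyz : y ≠ z) (hxz : x ≠ z) (hg : g ≠ 0) (hgx : inner ℝ g (x - v) = 0)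
    (hgy : inner ℝ g (y - v) = 0) (hgz : inner ℝ g (z - v) = 0) : False := by
  have hpos : ∀ {x}, IsEdge P (segment ℝ v x) → 0 < inner ℝ n (x - v) := fun h =>
    hn _ (mem_of_isEdge_segment h).2 (ne_of_isEdge_segment h)
  rcases exists_nonneg_comb hg hgx hgy hgz (hpos hx) (hpos hy) (hpos hz) with h | h | h
  · exact not_comb_of_isEdge hP hy hx hz hxy.symm hxz.symm h
  · exact not_comb_of_isEdge hP hx hy hz hxy hyz.symm h
  · exact not_comb_of_isEdge hP hx hz hy hxz hyz h

/-! ### Optimality of minimum-width directions and the position of feet. -/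

/-- First-order optimality of a direction `m` in which `P` has minimum width. -/
lemma le_of_minWidth_direction {S P : Set (Space 3)} (hS : S.Finite) (hPS : P = convexHull ℝ S)
    (hne : P.Nonempty) {m u : Space 3} {h l M L : ℝ} (hm : ‖m‖ = 1) (hmu : inner ℝ m u = 0)
    (hh : ∀ x ∈ P, inner ℝ m x ≤ h) (hl : ∀ x ∈ P, l ≤ inner ℝ m x)
    (hM : ∀ x ∈ P, inner ℝ m x = h → inner ℝ u x ≤ M)
    (hL : ∀ x ∈ P, inner ℝ m x = l → L ≤ inner ℝ u x) (hw : h - l = minWidth P) : L ≤ M := by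
  have hPc : IsCompact P := hPS ▸ hS.isCompact_convexHull ℝ
  have h1 := eventually_perturb_le hS hPS u hh hM
  have h2 := eventually_perturb_le (n := -m) hS hPS (-u) (h := -l) (M := -L)
    (fun x hx => by rw [inner_neg_left]; linarith [hl x hx])
    (fun x hx hx' => by
      rw [inner_neg_left] at hx' ⊢
      linarith [hL x hx (neg_injective hx')])
  obtain ⟨ε, ⟨h3, h4⟩, hε⟩ := ((h1.and h2).and self_mem_nhdsWithin).exists
  have hε : 0 < ε := hε
  -- Tilting orthogonally to `m` does not shorten the normal, so no normalization is needed and the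
  -- slab width `h - l + ε (M - L)` is at least `minWidth P`.
  have hz : 1 ≤ ‖m + ε • u‖ := by
    have : ‖m + ε • u‖ ^ 2 = 1 + ‖ε • u‖ ^ 2 := by
      rw [norm_add_sq_real, real_inner_smul_right, hmu, hm]
      ring
    nlinarith [norm_nonneg (m + ε • u), sq_nonneg ‖ε • u‖]
  have h5 := minWidth_le_sub hPc hne hz (α := h + ε * M) (β := l + ε * L) h3 (fun x hx => by
    have := h4 x hx
    rw [smul_neg, ← neg_add, inner_neg_left] at this
    linarith)
  by_contra! hlt
  have := mul_lt_mul_of_pos_left hlt hε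
  linarith

/-- The affine hull of `A` stays in the hyperplane, and Cauchy–Schwarz bounds the distance to it.
Only this inequality is needed: the opposite bound comes from the width of the slab. -/
lemma sub_le_rho {A : Set (Space 3)} {n x₀ : Space 3} {h : ℝ} (hn : ‖n‖ = 1) (hA : A.Nonempty)
    (hh : ∀ y ∈ A, inner ℝ n y = h) : h - inner ℝ n x₀ ≤ rho {x₀} A := by
  obtain ⟨y₀, hy₀⟩ := hA
  refine le_csInf ⟨_, x₀, mem_affineSpan ℝ rfl, y₀, mem_affineSpan ℝ hy₀, rfl⟩ ?_
  rintro _ ⟨x, hx, y, hy, rfl⟩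
  rw [AffineSubspace.mem_affineSpan_singleton] at hx
  subst hx
  have hspan : affineSpan ℝ A ≤ AffineSubspace.mk' y₀ (innerₛₗ ℝ n).ker := by
    rw [affineSpan_le]
    intro z hz
    rw [SetLike.mem_coe, AffineSubspace.mem_mk']
    simp [inner_sub_right, hh z hz, hh y₀ hy₀]
  have h1 := hspan hy
  rw [AffineSubspace.mem_mk'] at h1
  have h2 : inner ℝ n y = h := by
    rw [← hh y₀ hy₀]
    simpa [inner_sub_right, sub_eq_zero] using h1
  have h3 := real_inner_le_norm n (y - x)
  rw [hn, one_mul, inner_sub_right, h2, norm_sub_rev] at h3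
  exact h3

/-- If a facet and a vertex are strictly antipodal and their distance is the minimum width, then
the minimum width is attained in the normal direction of the facet. -/
lemma inner_sub_eq_minWidth {P F : Set (Space 3)} (hP : IsCompact P) {n v y₀ : Space 3}
    (hn : ‖n‖ = 1) (hF : supportingHyperplane P n ∩ P = F)
    (hv : supportingHyperplane P (-n) ∩ P = {v}) (hy₀ : y₀ ∈ F) (hrho : rho {v} F = minWidth P) :
    inner ℝ n y₀ - inner ℝ n v = minWidth P := by
  obtain ⟨h1, h2, h3⟩ := face_facts hP hF hy₀
  obtain ⟨h4, h5, h6⟩ := face_facts hP hv rfl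
  refine le_antisymm ?_ ?_
  · rw [← hrho]
    exact sub_le_rho hn ⟨y₀, hy₀⟩ fun y hy => ((h3 y).1 hy).2
  · refine minWidth_le_sub hP ⟨v, h4⟩ hn.ge h2 fun x hx => ?_
    have := h5 x hx
    rw [inner_neg_left, inner_neg_left] at this
    linarith

lemma inner_sub_pos_of_exposed {P : Set (Space 3)} (hP : IsCompact P) {n v x : Space 3}
    (hv : supportingHyperplane P (-n) ∩ P = {v}) (hx : x ∈ P) (hxv : x ≠ v) :
    0 < inner ℝ n (x - v) := by
  obtain ⟨h4, h5, h6⟩ := face_facts hP hv rfl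
  have h7 := h5 x hx
  have h8 : inner ℝ (-n) x ≠ inner ℝ (-n) v := fun h => hxv ((h6 x).2 ⟨hx, h⟩)
  have h9 := lt_of_le_of_ne h7 h8
  rw [inner_neg_left, inner_neg_left] at h9
  rw [inner_sub_right]
  linarith

/-- A vector of the plane `g^⊥` that is nonnegative on the dual cone of `b`, `b'` in that plane is
a nonnegative combination of `b` and `b'`. -/
lemma exists_comb_of_dual {g b b' q : Space 3} (hg : g ≠ 0) (hb : inner ℝ g b = 0)
    (hb' : inner ℝ g b' = 0) (hq : inner ℝ g q = 0) (hli : LinearIndependent ℝ ![b, b'])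
    (hdual : ∀ u : Space 3, inner ℝ g u = 0 → 0 ≤ inner ℝ u b → 0 ≤ inner ℝ u b' →
      0 ≤ inner ℝ u q) : ∃ α β : ℝ, 0 ≤ α ∧ 0 ≤ β ∧ q = α • b + β • b' := by
  have hspan : Submodule.span ℝ (Set.range ![b, b']) = (Submodule.span ℝ {g})ᗮ := by
    apply Submodule.eq_of_le_of_finrank_eq
    · rw [Submodule.span_le]
      rintro _ ⟨i, rfl⟩
      rw [SetLike.mem_coe, Submodule.mem_orthogonal_singleton_iff_inner_right]
      fin_cases i <;> simp [hb, hb']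
    · have h4 := Submodule.finrank_add_finrank_orthogonal (Submodule.span ℝ {g})
      rw [finrank_span_singleton hg] at h4
      rw [finrank_span_eq_card hli]
      simp at h4 ⊢
      omega
  have hqs : q ∈ Submodule.span ℝ (Set.range ![b, b']) := by
    rw [hspan, Submodule.mem_orthogonal_singleton_iff_inner_right]
    exact hq
  rw [Matrix.range_cons, Matrix.range_cons, Matrix.range_empty, Set.union_empty,
    Set.singleton_union, Submodule.mem_span_pair] at hqs
  obtain ⟨α, β, rfl⟩ := hqs
  have hcs : 0 < inner ℝ b b * inner ℝ b' b' - inner ℝ b b' * inner ℝ b b' := by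
    have h0 : b ≠ 0 := hli.ne_zero 0
    have h1 : b' - (inner ℝ b b' / inner ℝ b b) • b ≠ 0 := fun h => by
      rw [LinearIndependent.pair_iff] at hli
      have := hli (-(inner ℝ b b' / inner ℝ b b)) 1 (by rw [← h]; module)
      exact one_ne_zero this.2
    have h2 : 0 < inner ℝ b b := by
      rw [real_inner_self_eq_norm_sq]
      have := norm_pos_iff.2 h0
      positivity
    have h3 : 0 < inner ℝ (b' - (inner ℝ b b' / inner ℝ b b) • b)
        (b' - (inner ℝ b b' / inner ℝ b b) • b) := by
      rw [real_inner_self_eq_norm_sq]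
      have := norm_pos_iff.2 h1
      positivity
    simp only [inner_sub_left, inner_sub_right, real_inner_smul_left, real_inner_smul_right,
      real_inner_comm b b'] at h3
    have h4 := mul_pos h2 h3
    field_simp at h4
    nlinarith
  refine ⟨α, β, ?_, ?_, rfl⟩
  -- This test vector is orthogonal to `b'`, and its product with `b` is the Gram determinant;
  -- pairing with `q` isolates `α`.
  · have := hdual (inner ℝ b' b' • b - inner ℝ b b' • b')
      (by simp [inner_sub_right, real_inner_smul_right, hb, hb'])
      (by
        simp only [inner_sub_left, real_inner_smul_left, real_inner_comm b b']
        linarith)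
      (by
        simp only [inner_sub_left, real_inner_smul_left]
        linarith)
    simp only [inner_sub_left, inner_add_right, real_inner_smul_left, real_inner_smul_right,
      real_inner_comm b b'] at this
    have h1 : 0 ≤ α * (inner ℝ b b * inner ℝ b' b' - inner ℝ b b' * inner ℝ b b') := by linarith
    exact nonneg_of_mul_nonneg_left h1 hcs
  · have := hdual (inner ℝ b b • b' - inner ℝ b b' • b)
      (by simp [inner_sub_right, real_inner_smul_right, hb, hb'])
      (by
        simp only [inner_sub_left, real_inner_smul_left, real_inner_comm b b']
        linarith)
      (by
        simp only [inner_sub_left, real_inner_smul_left]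
        linarith)
    simp only [inner_sub_left, inner_add_right, real_inner_smul_left, real_inner_smul_right,
      real_inner_comm b b'] at this
    have h1 : 0 ≤ β * (inner ℝ b b * inner ℝ b' b' - inner ℝ b b' * inner ℝ b b') := by linarith
    exact nonneg_of_mul_nonneg_left h1 hcs

/-- If the facet `G` and the vertex `a` are strictly antipodal at distance `ω(P)`, then the foot of
`a` in the plane of `G` lies in the cone of `G` at its vertex `v`. -/
lemma foot_mem_cone {S P G : Set (Space 3)} (hS : S.Finite) (hPS : P = convexHull ℝ S)
    {v n g a x y : Space 3} (hn : ∀ x ∈ P, x ≠ v → 0 < inner ℝ n (x - v)) (hG : IsFacet P G)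
    (hedges : ∀ e, IsEdge P e → v ∈ e → ∃ z, e = segment ℝ v z)
    (hx : IsEdge P (segment ℝ v x)) (hy : IsEdge P (segment ℝ v y)) (hxy : x ≠ y)
    (hxG : segment ℝ v x ⊆ G) (hyG : segment ℝ v y ⊆ G) (hg : ‖g‖ = 1)
    (hgG : supportingHyperplane P g ∩ P = G) (hga : supportingHyperplane P (-g) ∩ P = {a})
    (hw : inner ℝ g v - inner ℝ g a = minWidth P) :
    ∃ α β : ℝ, 0 ≤ α ∧ 0 ≤ β ∧
      a - v + minWidth P • g = α • (x - v) + β • (y - v) := by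
  have hPc : IsCompact P := hPS ▸ hS.isCompact_convexHull ℝ
  have hvG : v ∈ G := hxG (left_mem_segment ℝ v x)
  obtain ⟨hvP, hgle, hmem⟩ := face_facts hPc hgG hvG
  obtain ⟨haP, hale, hamem⟩ := face_facts hPc hga rfl
  have hg0 : g ≠ 0 := by
    rintro rfl
    simp at hg
  have hGg : ∀ z ∈ G, inner ℝ g (z - v) = 0 := fun z hz => by
    rw [inner_sub_right, ((hmem z).1 hz).2, sub_self]
  have hgx := hGg x (hxG (right_mem_segment ℝ v x))
  have hgy := hGg y (hyG (right_mem_segment ℝ v y))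
  have hnx := hn x (mem_of_isEdge_segment hx).2 (ne_of_isEdge_segment hx)
  have hny := hn y (mem_of_isEdge_segment hy).2 (ne_of_isEdge_segment hy)
  refine exists_comb_of_dual hg0 hgx hgy ?_ ?_ ?_
  · rw [inner_add_right, inner_sub_right, real_inner_smul_right, real_inner_self_eq_norm_sq, hg]
    linarith
  · rw [LinearIndependent.pair_iff' (sub_ne_zero.2 (ne_of_isEdge_segment hx))]
    intro t ht
    refine hxy (eq_of_sub_eq_smul hPc hx hy ht.symm ?_).symm
    rw [← ht, real_inner_smul_right] at hny
    exact (pos_of_mul_pos_left hny hnx.le).le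
  · intro u hgu hux huy
    -- A negative value would occur on a third edge of `G` at `v`, coplanar with the given two, or
    -- make `u` a negative multiple of `n` on `G - v`; both are impossible.
    have hcone : ∀ z ∈ G, 0 ≤ inner ℝ u (z - v) := by
      intro z hz
      by_contra! hneg
      rcases exists_edge_neg hS hPS hG hvG (fun z hz => hn z ((hmem z).1 hz).1) hz hneg with
        ⟨e, he, heG, hve, z', hz', hz'neg⟩ | ⟨t, ht, h1⟩
      · obtain ⟨z₁, rfl⟩ := hedges e he hve
        rw [segment_eq_image'] at hz'
        obtain ⟨s, hs, rfl⟩ := hz'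
        rw [add_sub_cancel_left, real_inner_smul_right] at hz'neg
        have h2 : inner ℝ u (z₁ - v) < 0 := by
          by_contra! h
          have := mul_nonneg hs.1 h
          linarith
        refine not_coplanar_of_isEdge hPc hn hx hy he hxy ?_ ?_ hg0 hgx hgy
          (hGg z₁ (heG (right_mem_segment ℝ v z₁)))
        · rintro rfl
          linarith
        · rintro rfl
          linarith
      · have h2 := h1 x (hxG (right_mem_segment ℝ v x))
        have := mul_neg_of_neg_of_pos ht hnx
        linarith
    have h1 := le_of_minWidth_direction (m := -g) (u := u) hS hPS ⟨v, hvP⟩ (by rwa [norm_neg])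
      (by rw [inner_neg_left, hgu, neg_zero]) (h := inner ℝ (-g) a) (l := inner ℝ (-g) v)
      (M := inner ℝ u a) (L := inner ℝ u v) hale
      (fun x hx => by rw [inner_neg_left, inner_neg_left]; linarith [hgle x hx])
      (fun x hx hxa => by
        have : x = a := (hamem x).2 ⟨hx, hxa⟩
        rw [this])
      (fun x hx hxv => by
        rw [inner_neg_left, inner_neg_left, neg_inj] at hxv
        have := hcone x ((hmem x).2 ⟨hx, hxv⟩)
        rw [inner_sub_right] at this
        linarith)
      (by rw [inner_neg_left, inner_neg_left]; linarith)
    rw [inner_add_right, real_inner_smul_right, inner_sub_right, real_inner_comm g u, hgu]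
    linarith

/-! ### Total angles by counting crossings with generic planes. -/

/-- The integrals of the indicators of a finite family of sets. -/
lemma integral_sum_indicator {ι : Type*} [Fintype ι] (D : ι → Set (Space 3))
    (hD : ∀ i, MeasurableSet (D i)) (hfin : ∀ i, volume (D i) ≠ ⊤) :
    Integrable (fun u => ∑ i, (D i).indicator (fun _ => (1 : ℝ)) u) ∧
      ∫ u, ∑ i, (D i).indicator (fun _ => (1 : ℝ)) u = ∑ i, volume.real (D i) := by
  have h : ∀ i, Integrable ((D i).indicator (fun _ => (1 : ℝ))) := fun i =>
    (integrable_indicator_iff (hD i)).2 (integrableOn_const (hfin i))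
  refine ⟨integrable_finsetSum _ fun i _ => h i, ?_⟩
  rw [integral_finsetSum _ fun i _ => h i]
  refine Finset.sum_congr rfl fun i _ => ?_
  rw [integral_indicator_const _ (hD i), smul_eq_mul, mul_one]

/-- A closed chain of vectors not contained in an open half space turns through at least the full
angle. -/
lemma two_mul_volume_ball_le_sum {k : ℕ} [NeZero k] {x : Fin k → Space 3} (hx : ∀ j, x j ≠ 0)
    (h : ∀ u : Space 3, ∃ j, 0 ≤ inner ℝ (x j) u) :
    2 * volume.real (Metric.ball (0 : Space 3) 1) ≤ ∑ j, splitVol (x (j - 1)) (x j) := by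
  obtain ⟨h1, h2⟩ := integral_sum_indicator (fun j => signSplit (x (j - 1)) (x j))
    (fun j => (isOpen_signSplit _ _).measurableSet) (fun j => volume_signSplit_ne_top _ _)
  have h3 : ∫ u, (Metric.ball (0 : Space 3) 1).indicator (fun _ => (2 : ℝ)) u =
      2 * volume.real (Metric.ball (0 : Space 3) 1) := by
    rw [integral_indicator_const _ measurableSet_ball, smul_eq_mul, mul_comm]
  unfold splitVol
  rw [← h2, ← h3]
  refine integral_mono_ae ((integrable_indicator_iff measurableSet_ball).2
    (integrableOn_const measure_ball_lt_top.ne)) h1 ?_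
  have hae : ∀ᵐ u : Space 3, ∀ j, inner ℝ (x j) u ≠ 0 :=
    ae_all_iff.2 fun j => ae_inner_ne_zero (hx j)
  filter_upwards [hae] with u hu
  by_cases hub : u ∈ Metric.ball (0 : Space 3) 1
  swap
  · rw [Set.indicator_of_notMem hub]
    exact Finset.sum_nonneg fun j _ => Set.indicator_nonneg (fun _ _ => zero_le_one) _
  have hun : ‖u‖ < 1 := by simpa using hub
  rw [Set.indicator_of_mem hub]
  have hs1 : ∃ j, 0 < inner ℝ (x j) u := by
    obtain ⟨j, hj⟩ := h u
    exact ⟨j, lt_of_le_of_ne hj (hu j).symm⟩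
  have hs2 : ∃ j, ¬ 0 < inner ℝ (x j) u := by
    obtain ⟨j, hj⟩ := h (-u)
    rw [inner_neg_right] at hj
    exact ⟨j, by linarith⟩
  -- Both signs occur on the cycle, so there is a change upwards and another one downwards.
  obtain ⟨j₁, h4, h5⟩ := exists_sub_one_of_exists hs1 hs2
  obtain ⟨j₂, h6, h7⟩ := exists_sub_one_of_exists (s := fun j => ¬ 0 < inner ℝ (x j) u) hs2
    (by simpa using hs1)
  have hne : j₁ ≠ j₂ := by
    rintro rfl
    exact h7 h5
  have h8 : ({j₁, j₂} : Finset (Fin k)).sum (fun j => (signSplit (x (j - 1)) (x j)).indicator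
      (fun _ => (1 : ℝ)) u) = 2 := by
    rw [Finset.sum_pair hne, Set.indicator_of_mem, Set.indicator_of_mem]
    · norm_num
    · refine ⟨hun, mul_neg_of_pos_of_neg (not_not.1 h6) (lt_of_le_of_ne (not_lt.1 h7) (hu j₂))⟩
    · refine ⟨hun, mul_neg_of_neg_of_pos (lt_of_le_of_ne (not_lt.1 h4) (hu _)) h5⟩
  rw [← h8]
  exact Finset.sum_le_univ_sum_of_nonneg fun j => Set.indicator_nonneg (fun _ _ => zero_le_one) _

/-- A family of pairs of vectors in an open half space of which at most two are separated by any
generic plane has total angle less than the full angle. -/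
lemma sum_lt_two_mul_volume_ball {ι : Type*} [Fintype ι] {b b' : ι → Space 3} {n : Space 3}
    (hb : ∀ p, 0 < inner ℝ n (b p)) (hb' : ∀ p, 0 < inner ℝ n (b' p))
    (h : ∀ u : Space 3, (∀ p, inner ℝ (b p) u ≠ 0) → (∀ p, inner ℝ (b' p) u ≠ 0) →
      ∀ s : Finset ι, (∀ p ∈ s, inner ℝ (b p) u * inner ℝ (b' p) u < 0) → s.card ≤ 2) :
    ∑ p, splitVol (b p) (b' p) < 2 * volume.real (Metric.ball (0 : Space 3) 1) := by
  classical
  obtain ⟨h1, h2⟩ := integral_sum_indicator (fun p => signSplit (b p) (b' p))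
    (fun j => (isOpen_signSplit _ _).measurableSet) (fun j => volume_signSplit_ne_top _ _)
  set U : Set (Space 3) := Metric.ball 0 1 ∩
    ⋂ p, ({u | 0 < inner ℝ (b p) u} ∩ {u | 0 < inner ℝ (b' p) u}) with hU
  have hUo : IsOpen U := Metric.isOpen_ball.inter (isOpen_iInter_of_finite fun p =>
    (isOpen_lt (f := fun _ : Space 3 => (0 : ℝ)) (g := fun u => inner ℝ (b p) u)
      (by fun_prop) (by fun_prop)).inter
    (isOpen_lt (f := fun _ : Space 3 => (0 : ℝ)) (g := fun u => inner ℝ (b' p) u)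
      (by fun_prop) (by fun_prop)))
  have hUsub : U ⊆ Metric.ball 0 1 := Set.inter_subset_left
  have hUfin : volume U ≠ ⊤ := ((measure_mono hUsub).trans_lt measure_ball_lt_top).ne
  -- No pair is separated by a plane with normal in `U`. A small multiple of `n` lies in this open
  -- set, which makes the inequality strict.
  have hUne : U.Nonempty := by
    have hpos : 0 < (1 + ‖n‖)⁻¹ := by positivity
    refine ⟨(1 + ‖n‖)⁻¹ • n, ?_, ?_⟩
    · rw [mem_ball_zero_iff, norm_smul, norm_inv, Real.norm_of_nonneg (by positivity),
        inv_mul_lt_one₀ (by positivity)]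
      linarith
    · simp only [Set.mem_iInter, Set.mem_inter_iff, Set.mem_ofPred_eq, real_inner_smul_right]
      intro p
      rw [real_inner_comm, real_inner_comm n (b' p)]
      exact ⟨mul_pos hpos (hb p), mul_pos hpos (hb' p)⟩
  have hUpos : 0 < volume.real U :=
    ENNReal.toReal_pos (hUo.measure_pos volume hUne).ne' hUfin
  have hi1 : Integrable ((Metric.ball (0 : Space 3) 1).indicator (fun _ => (2 : ℝ))) :=
    (integrable_indicator_iff measurableSet_ball).2 (integrableOn_const measure_ball_lt_top.ne)
  have hi2 : Integrable (U.indicator (fun _ => (2 : ℝ))) :=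
    (integrable_indicator_iff hUo.measurableSet).2 (integrableOn_const hUfin)
  have h3 : ∫ u, ((Metric.ball (0 : Space 3) 1).indicator (fun _ => (2 : ℝ)) u -
      U.indicator (fun _ => (2 : ℝ)) u) =
      2 * volume.real (Metric.ball (0 : Space 3) 1) - 2 * volume.real U := by
    rw [integral_sub hi1 hi2, integral_indicator_const _ measurableSet_ball,
      integral_indicator_const _ hUo.measurableSet, smul_eq_mul, smul_eq_mul, mul_comm,
      mul_comm (2 : ℝ)]
    ring
  have h4 : ∑ p, splitVol (b p) (b' p) ≤
      2 * volume.real (Metric.ball (0 : Space 3) 1) - 2 * volume.real U := by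
    unfold splitVol
    rw [← h2, ← h3]
    refine integral_mono_ae h1 (hi1.sub hi2) ?_
    have ne0 : ∀ {x : Space 3}, 0 < inner ℝ n x → x ≠ 0 := by
      rintro x hx rfl
      simp at hx
    have hae : ∀ᵐ u : Space 3, ∀ p, inner ℝ (b p) u ≠ 0 :=
      ae_all_iff.2 fun p => ae_inner_ne_zero (ne0 (hb p))
    have hae' : ∀ᵐ u : Space 3, ∀ p, inner ℝ (b' p) u ≠ 0 :=
      ae_all_iff.2 fun p => ae_inner_ne_zero (ne0 (hb' p))
    filter_upwards [hae, hae'] with u hu hu'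
    by_cases hub : u ∈ Metric.ball (0 : Space 3) 1
    swap
    · rw [Set.indicator_of_notMem hub, Set.indicator_of_notMem fun h => hub (hUsub h), sub_zero]
      refine (Finset.sum_eq_zero fun p _ => Set.indicator_of_notMem (fun h => hub ?_) _).le
      exact signSplit_subset_ball _ _ h
    rw [Set.indicator_of_mem hub]
    by_cases huU : u ∈ U
    · rw [Set.indicator_of_mem huU, sub_self]
      refine (Finset.sum_eq_zero fun p _ => Set.indicator_of_notMem (fun hp => ?_) _).le
      have h5 := Set.mem_iInter.1 huU.2 p
      have h6 : 0 < inner ℝ (b p) u * inner ℝ (b' p) u := mul_pos h5.1 h5.2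
      exact absurd hp.2 h6.not_gt
    · rw [Set.indicator_of_notMem huU, sub_zero]
      have h5 := h u hu hu' (Finset.univ.filter fun p => u ∈ signSplit (b p) (b' p))
        (fun p hp => (Finset.mem_filter.1 hp).2.2)
      calc ∑ p, (signSplit (b p) (b' p)).indicator (fun _ => (1 : ℝ)) u
          = ((Finset.univ.filter fun p => u ∈ signSplit (b p) (b' p)).card : ℝ) := by
            simp [Set.indicator_apply]
        _ ≤ 2 := by exact_mod_cast h5
  linarith

/-- Inserting a vector `q` into one step of a chain. -/
lemma splitVol_chain {f : ℕ → Space 3} (hf : ∀ l, f l ≠ 0) {q : Space 3} {l N : ℕ} (hl : l < N)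
    (hq : splitVol (f l) q + splitVol q (f (l + 1)) ≤ splitVol (f l) (f (l + 1))) :
    splitVol (f 0) q + splitVol q (f N) ≤
      ∑ m ∈ Finset.range N, splitVol (f m) (f (m + 1)) := by
  obtain ⟨d, rfl⟩ := Nat.exists_eq_add_of_le (Nat.succ_le_of_lt hl)
  have h1 : ∀ l, splitVol (f 0) q ≤
      ∑ m ∈ Finset.range l, splitVol (f m) (f (m + 1)) + splitVol (f l) q := by
    intro l
    induction l with
    | zero => simp
    | succ l ih =>
      rw [Finset.sum_range_succ]
      linarith [splitVol_triangle (hf (l + 1)) (f l) q]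
  have h2 : ∀ m d, splitVol q (f (m + d)) ≤ splitVol q (f m) +
      ∑ j ∈ Finset.range d, splitVol (f (m + j)) (f (m + j + 1)) := by
    intro m d
    induction d with
    | zero => simp
    | succ d ih =>
      rw [Finset.sum_range_succ]
      change splitVol q (f (m + d + 1)) ≤ _
      linarith [splitVol_triangle (hf (m + d)) q (f (m + d + 1))]
  rw [Finset.sum_range_add, Finset.sum_range_succ]
  linarith [h1 l, h2 (l + 1) d]


/-- A plane through `v` that contains no edge at `v` separates at most two pairs of consecutive
edges at `v`. -/
lemma card_crossing_le_two {ι : Type*} {P : Set (Space 3)} (hP : IsCompact P) {v n : Space 3}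
    (hn : ∀ x ∈ P, x ≠ v → 0 < inner ℝ n (x - v)) {W g : ι → Space 3} {σ : ι → ι}
    (hW : Function.Injective W) (hσ : ∀ p, σ p ≠ p) (hσσ : ∀ p, σ (σ p) ≠ p)
    (hedge : ∀ p, IsEdge P (segment ℝ v (W p))) (hg0 : ∀ p, g p ≠ 0)
    (hgle : ∀ p, ∀ x ∈ P, inner ℝ (g p) (x - v) ≤ 0)
    (hg1 : ∀ p, inner ℝ (g p) (W p - v) = 0) (hg2 : ∀ p, inner ℝ (g p) (W (σ p) - v) = 0)
    {u : Space 3} {s : Finset ι}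
    (hs : ∀ p ∈ s, inner ℝ (W p - v) u * inner ℝ (W (σ p) - v) u < 0) : s.card ≤ 2 := by
  -- Otherwise the plane of `g q` would contain three distinct edges at `v`.
  have share : ∀ p q, p ≠ q → inner ℝ (g q) (W p - v) = 0 → inner ℝ (g q) (W (σ p) - v) = 0 →
      False := by
    intro p q hpq h1 h2
    by_cases h : σ p = q
    · refine not_coplanar_of_isEdge hP hn (hedge p) (hedge q) (hedge (σ q)) (hW.ne hpq)
        (hW.ne (hσ q).symm) (hW.ne ?_) (hg0 q) h1 (hg1 q) (hg2 q)
      rw [← h]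
      exact (hσσ p).symm
    · exact not_coplanar_of_isEdge hP hn (hedge p) (hedge (σ p)) (hedge q) (hW.ne (hσ p).symm)
        (hW.ne h) (hW.ne hpq) (hg0 q) h1 h2 (hg1 q)
  -- For a separated pair, `c p` is where its cone meets the plane `u^⊥`. Among three such vectors
  -- one is in the cone of the others, but `g q` vanishes at `c q` and is negative at the other two.
  set c : ι → Space 3 := fun p => |inner ℝ (W (σ p) - v) u| • (W p - v) +
    |inner ℝ (W p - v) u| • (W (σ p) - v) with hc
  have hpos : ∀ p, 0 < inner ℝ n (W p - v) := fun p =>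
    hn _ (mem_of_isEdge_segment (hedge p)).2 (ne_of_isEdge_segment (hedge p))
  have hcoef : ∀ p ∈ s, 0 < |inner ℝ (W (σ p) - v) u| ∧ 0 < |inner ℝ (W p - v) u| := fun p hp =>
    ⟨abs_pos.2 (right_ne_zero_of_mul (hs p hp).ne), abs_pos.2 (left_ne_zero_of_mul (hs p hp).ne)⟩
  have hcn : ∀ p ∈ s, 0 < inner ℝ n (c p) := fun p hp => by
    simp only [hc, inner_add_right, real_inner_smul_right]
    exact add_pos (mul_pos (hcoef p hp).1 (hpos p)) (mul_pos (hcoef p hp).2 (hpos (σ p)))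
  have hcu : ∀ p ∈ s, inner ℝ u (c p) = 0 := fun p hp => by
    simp only [hc, inner_add_right, real_inner_smul_right, real_inner_comm (W _ - v) u]
    rcases mul_neg_iff.1 (hs p hp) with ⟨h1, h2⟩ | ⟨h1, h2⟩
    · rw [abs_of_pos h1, abs_of_neg h2]
      ring
    · rw [abs_of_neg h1, abs_of_pos h2]
      ring
  have hgc : ∀ q, ∀ p ∈ s, inner ℝ (g q) (c p) ≤ 0 ∧ (inner ℝ (g q) (c p) = 0 → p = q) := by
    intro q p hp
    have h1 := hgle q _ (mem_of_isEdge_segment (hedge p)).2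
    have h2 := hgle q _ (mem_of_isEdge_segment (hedge (σ p))).2
    have h3 := mul_nonpos_of_nonneg_of_nonpos (hcoef p hp).1.le h1
    have h4 := mul_nonpos_of_nonneg_of_nonpos (hcoef p hp).2.le h2
    simp only [hc, inner_add_right, real_inner_smul_right]
    refine ⟨add_nonpos h3 h4, fun h5 => ?_⟩
    by_contra hpq
    refine share p q hpq ?_ ?_
    · exact (mul_eq_zero.1 (by linarith : |inner ℝ (W (σ p) - v) u| *
        inner ℝ (g q) (W p - v) = 0)).resolve_left (hcoef p hp).1.ne'
    · exact (mul_eq_zero.1 (by linarith : |inner ℝ (W p - v) u| *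
        inner ℝ (g q) (W (σ p) - v) = 0)).resolve_left (hcoef p hp).2.ne'
  have hgcc : ∀ q, inner ℝ (g q) (c q) = 0 := fun q => by
    simp only [hc, inner_add_right, real_inner_smul_right, hg1, hg2, mul_zero, add_zero]
  have hcomb : ∀ p ∈ s, ∀ q ∈ s, ∀ r ∈ s, p ≠ q → r ≠ q →
      ¬ ∃ α β : ℝ, 0 ≤ α ∧ 0 ≤ β ∧ c q = α • c p + β • c r := by
    rintro p hp q hq r hr hpq hrq ⟨α, β, hα, hβ, h⟩
    have h1 := hgcc q
    rw [h, inner_add_right, real_inner_smul_right, real_inner_smul_right] at h1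
    have h2 := lt_of_le_of_ne (hgc q p hp).1 fun h => hpq ((hgc q p hp).2 h)
    have h3 := lt_of_le_of_ne (hgc q r hr).1 fun h => hrq ((hgc q r hr).2 h)
    have h4 := mul_nonpos_of_nonneg_of_nonpos hα h2.le
    have h5 := mul_nonpos_of_nonneg_of_nonpos hβ h3.le
    have hα0 := (mul_eq_zero.1 (by linarith : α * inner ℝ (g q) (c p) = 0)).resolve_right h2.ne
    have hβ0 := (mul_eq_zero.1 (by linarith : β * inner ℝ (g q) (c r) = 0)).resolve_right h3.ne
    have h6 := hcn q hq
    rw [h, hα0, hβ0, zero_smul, zero_smul, add_zero, inner_zero_right] at h6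
    exact lt_irrefl _ h6
  by_contra! hcard
  obtain ⟨p, hp, q, hq, r, hr, hpq, hpr, hqr⟩ := Finset.two_lt_card.1 hcard
  have hu0 : u ≠ 0 := by
    rintro rfl
    have := hs p hp
    simp at this
  rcases exists_nonneg_comb hu0 (hcu p hp) (hcu q hq) (hcu r hr) (hcn p hp) (hcn q hq) (hcn r hr)
    with h | h | h
  · exact hcomb q hq p hp r hr hpq.symm hpr.symm h
  · exact hcomb p hp q hq r hr hpq hqr.symm h
  · exact hcomb p hp r hr q hq hpr hqr h

/-! ### The comparison applied to feet, and the vertices of the facet. -/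

/-- The angle at the foot of `v` between two consecutive vertices `a'`, `a` of the opposite facet
is at most the angle, measured through the edge direction `b`, between the feet of `a'` and `a` on
facets at `v`. -/
lemma splitVol_foot_le {v n g g' a a' b c : Space 3} {ω D : ℝ} (hn : ‖n‖ = 1) (hg : ‖g‖ = 1)
    (hg' : ‖g'‖ = 1) (hc : ‖c‖ = 1) (hω : 0 ≤ ω) (hD : ω ≤ D) (hb : b ≠ 0)
    (hna : inner ℝ n (a - v) = ω) (hna' : inner ℝ n (a' - v) = ω)
    (hga : inner ℝ g (a - v) = -ω) (hga' : inner ℝ g' (a' - v) = -ω) (hgb : inner ℝ g b ≤ 0)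
    (hgb' : inner ℝ g' b ≤ 0) (hcb : inner ℝ c b = 0) (hca : inner ℝ c (a - v) = D)
    (hca' : inner ℝ c (a' - v) = D) (hx : a - v - ω • n ≠ 0) (hx' : a' - v - ω • n ≠ 0) :
    splitVol (a' - v - ω • n) (a - v - ω • n) ≤
      splitVol (a' - v + ω • g') b + splitVol b (a - v + ω • g) := by
  generalize a - v = A at *
  generalize a' - v = A' at *
  have hxsq : ∀ {B : Space 3}, inner ℝ n B = ω → ‖B - ω • n‖ ^ 2 = ‖B‖ ^ 2 - ω ^ 2 := by
    intro B hB
    rw [norm_sub_sq_real, real_inner_smul_right, real_inner_comm, hB, norm_smul, hn, mul_one,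
      Real.norm_eq_abs, sq_abs]
    ring
  have hqsq : ∀ {B g : Space 3}, ‖g‖ = 1 → inner ℝ g B = -ω →
      ‖B + ω • g‖ ^ 2 = ‖B‖ ^ 2 - ω ^ 2 := by
    intro B g hg hB
    rw [norm_add_sq_real, real_inner_smul_right, real_inner_comm, hB, norm_smul, hg, mul_one,
      Real.norm_eq_abs, sq_abs]
    ring
  have hq : ‖A + ω • g‖ = ‖A - ω • n‖ := by
    rw [← sq_eq_sq₀ (norm_nonneg _) (norm_nonneg _), hxsq hna, hqsq hg hga]
  have hq' : ‖A' + ω • g'‖ = ‖A' - ω • n‖ := by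
    rw [← sq_eq_sq₀ (norm_nonneg _) (norm_nonneg _), hxsq hna', hqsq hg' hga']
  have hb0 := norm_pos_iff.2 hb
  -- Since `b` points into the half space of the facet, passing to the foot can only decrease the
  -- component along `b`.
  have hproj : ∀ {B g : Space 3}, inner ℝ g b ≤ 0 →
      inner ℝ (B + ω • g) (‖b‖⁻¹ • b) ≤ inner ℝ B (‖b‖⁻¹ • b) := by
    intro B g hgb
    rw [inner_add_left, real_inner_smul_left, real_inner_smul_right _ _ (‖b‖⁻¹)]
    have h1 : ‖b‖⁻¹ * inner ℝ g b ≤ 0 := mul_nonpos_of_nonneg_of_nonpos (by positivity) hgb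
    have h2 := mul_nonpos_of_nonneg_of_nonpos hω h1
    rw [real_inner_smul_right]
    linarith
  refine splitVol_le_add_of_angle_le hx hx' hb ?_ ?_ ?_
  · rwa [← norm_pos_iff, hq, norm_pos_iff]
  · rwa [← norm_pos_iff, hq', norm_pos_iff]
  have key := angle_le_angle_add_angle (A := A) (A' := A') (x := A - ω • n) (x' := A' - ω • n)
    (e := ‖b‖⁻¹ • b) (q := A + ω • g) (q' := A' + ω • g') (c := c) (ω := ω) (D := D)
    (norm_smul_inv_norm hb) hc
    (by rw [real_inner_smul_left, real_inner_comm, hcb, mul_zero]) hω hD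
    (by rw [real_inner_comm, hca]) (by rw [real_inner_comm, hca']) (hxsq hna) (hxsq hna') hq hq'
    hx hx'
    (by
      simp only [inner_sub_left, inner_sub_right, real_inner_smul_left, real_inner_smul_right,
        real_inner_comm n A', hna, hna']
      rw [real_inner_self_eq_norm_sq, hn]
      ring)
    (by rw [real_inner_comm]; exact hproj hgb) (hproj hgb')
  rwa [InnerProductGeometry.angle_smul_right_of_pos _ _ (inv_pos.2 hb0),
    InnerProductGeometry.angle_smul_left_of_pos _ _ (inv_pos.2 hb0)] at key

/-- A linear functional is maximal over a facet at a vertex of the facet. -/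
lemma exists_vertex_ge {S P F : Set (Space 3)} (hS : S.Finite) (hPS : P = convexHull ℝ S)
    (hF : IsFacet P F) {k : ℕ} [NeZero k] {a : Fin k → Space 3}
    (haF : {e | IsEdge P e ∧ e ⊆ F} = {e | ∃ j : Fin k, e = segment ℝ (a (j - 1)) (a j)})
    (u : Space 3) {x : Space 3} (hx : x ∈ F) : ∃ j, inner ℝ u x ≤ inner ℝ u (a j) := by
  have ha0 : a 0 ∈ F := by
    have h : segment ℝ (a (0 - 1)) (a 0) ∈ {e | IsEdge P e ∧ e ⊆ F} := haF ▸ ⟨0, rfl⟩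
    exact h.2 (right_mem_segment ℝ _ _)
  by_cases h : inner ℝ u (a 0) = inner ℝ u x
  · exact ⟨0, h.ge⟩
  obtain ⟨e, he, heF, y, hy, hxy⟩ := exists_edge_isMax hS hPS hF hx ha0 h
  have h1 : e ∈ {e | ∃ j : Fin k, e = segment ℝ (a (j - 1)) (a j)} := haF ▸ ⟨he, heF⟩
  obtain ⟨j, rfl⟩ := h1
  rw [segment_eq_image] at hy
  obtain ⟨t, ht, rfl⟩ := hy
  rw [inner_add_right, real_inner_smul_right, real_inner_smul_right] at hxy
  by_contra! hcon
  have h1 := hcon (j - 1)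
  have h2 := hcon j
  have h3 : (1 - t) * inner ℝ u (a (j - 1)) ≤ (1 - t) * inner ℝ u x :=
    mul_le_mul_of_nonneg_left h1.le (by linarith [ht.2])
  have h4 : t * inner ℝ u (a j) ≤ t * inner ℝ u x := mul_le_mul_of_nonneg_left h2.le ht.1
  rcases ht.1.eq_or_lt with h0 | h0
  · rw [← h0] at hxy
    linarith
  · have := mul_lt_mul_of_pos_left h2 h0
    linarith

/-- A facet of a three-dimensional polytope has at least three edges. -/
lemma three_le_card {S P F : Set (Space 3)} (hS : S.Finite) (hPS : P = convexHull ℝ S)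
    (hF : IsFacet P F) {k : ℕ} [NeZero k] {a : Fin k → Space 3}
    (haF : {e | IsEdge P e ∧ e ⊆ F} = {e | ∃ j : Fin k, e = segment ℝ (a (j - 1)) (a j)}) :
    3 ≤ k := by
  by_contra! hk
  have ha0 : a 0 ∈ F := by
    have h : segment ℝ (a (0 - 1)) (a 0) ∈ {e | IsEdge P e ∧ e ⊆ F} := haF ▸ ⟨0, rfl⟩
    exact h.2 (right_mem_segment ℝ _ _)
  have hj : ∀ j : Fin k, j = 0 ∨ j = 1 := by
    intro j
    have hj2 := j.2
    have h0 : k ≠ 0 := NeZero.ne k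
    by_cases h : j.val = 0
    · left
      ext
      simpa using h
    · right
      ext
      rw [Fin.val_one', Nat.mod_eq_of_lt (by omega)]
      omega
  -- With at most two vertices, every functional orthogonal to `a 1 - a 0` is constant on `F`, which
  -- would put `F` on a line. For `k = 1` the index `1` is `0`.
  obtain ⟨z, hz, hzs⟩ := exists_notMem_span hF ha0 (a 1 - a 0)
  apply hzs
  rw [← Submodule.orthogonal_orthogonal (Submodule.span ℝ {a 1 - a 0}), Submodule.mem_orthogonal]
  intro u hu
  rw [Submodule.mem_orthogonal_singleton_iff_inner_left, inner_sub_right] at hu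
  have h1 : ∀ j, inner ℝ u (a j) = inner ℝ u (a 0) := fun j => by
    rcases hj j with rfl | rfl
    · rfl
    · linarith
  obtain ⟨j, h2⟩ := exists_vertex_ge hS hPS hF haF u hz
  obtain ⟨j', h3⟩ := exists_vertex_ge hS hPS hF haF (-u) hz
  rw [inner_neg_left, inner_neg_left, h1] at h3
  rw [h1] at h2
  rw [inner_sub_right]
  linarith

end ReducedPolytope

/-! ### The two angle sums and the contradiction. -/

open ReducedPolytope
/-- Indices `j : Fin k` are cyclic, so `a (j - 1)` precedes `a j` on the boundary of the facet `F`.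
The segments `[v, w j l]` are the edges at `v`; consecutive ones span the facets `G j l`. -/
theorem mainTheorem2
    (P : Set (Space 3)) (hP : IsPolytope P) (hred : IsReduced P)
    -- the facet `F` and its edges `a_1 a_2, …, a_{k-1} a_k, a_k a_1`
    (F : Set (Space 3)) (hF : IsFacet P F)
    (k : ℕ) [NeZero k] (a : Fin k → Space 3) (ha : Function.Injective a)
    (haF : {e | IsEdge P e ∧ e ⊆ F} = {e | ∃ j : Fin k, e = segment ℝ (a (j - 1)) (a j)})
    -- the vertex `v` and the edges incident to it, in `k` non-empty blocks
    (v : Space 3) (hv : IsVertex P v)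
    (i : Fin k → ℕ) (hi : ∀ j, 0 < i j)
    (w : (j : Fin k) → Fin (i j) → Space 3)
    (hw : Function.Injective (fun p : (j : Fin k) × Fin (i j) => w p.1 p.2))
    (hwv : {e | IsEdge P e ∧ v ∈ e} =
      {e | ∃ (j : Fin k) (l : Fin (i j)), e = segment ℝ v (w j l)})
    -- the edges are listed in cyclic order: consecutive ones lie in a common facet `G j l`
    (G : (j : Fin k) → Fin (i j) → Set (Space 3))
    (hG : ∀ (j : Fin k) (l : Fin (i j)), IsFacet P (G j l) ∧
      segment ℝ v (w j l) ⊆ G j l ∧ segment ℝ v (blockNext hi w j l) ⊆ G j l) :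
    ¬ ((StrictlyAntipodal P F {v} ∧ rho {v} F = minWidth P) ∧
       (∀ j : Fin k, StrictlyAntipodal P
          (segment ℝ v (w j ⟨0, hi j⟩)) (segment ℝ (a (j - 1)) (a j))) ∧
       (∀ j : Fin k, (∀ l : Fin (i j), StrictlyAntipodal P (G j l) {a j}) ∧
          ∃ l : Fin (i j), rho {a j} (G j l) = minWidth P)) := by
  rintro ⟨⟨⟨-, -, -, n, hn1, hnF, hnv⟩, hrho⟩, hb, hc⟩
  obtain ⟨S, hS, hPS⟩ := hP
  have hPc : IsCompact P := hPS ▸ hS.isCompact_convexHull ℝ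
  have hk := three_le_card hS hPS hF haF
  have haj : ∀ j, a j ∈ F := fun j => by
    have h : segment ℝ (a (j - 1)) (a j) ∈ {e | IsEdge P e ∧ e ⊆ F} := haF ▸ ⟨j, rfl⟩
    exact h.2 (right_mem_segment ℝ _ _)
  set ω := minWidth P with hω
  have hn : ∀ x ∈ P, x ≠ v → 0 < inner ℝ n (x - v) := fun x hx hxv =>
    inner_sub_pos_of_exposed hPc hnv hx hxv
  have hvP : v ∈ P := (face_facts hPc hnv rfl).1
  have hna : ∀ j, inner ℝ n (a j - v) = ω := fun j => by
    rw [inner_sub_right]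
    exact inner_sub_eq_minWidth hPc hn1 hnF hnv (haj j) hrho
  set W : (j : Fin k) × Fin (i j) → Space 3 := fun p => w p.1 p.2 with hWdef
  have hedge : ∀ p, IsEdge P (segment ℝ v (W p)) := fun p => by
    have h : segment ℝ v (W p) ∈ {e | IsEdge P e ∧ v ∈ e} := hwv ▸ ⟨p.1, p.2, rfl⟩
    exact h.1
  have hedges : ∀ e, IsEdge P e → v ∈ e → ∃ z, e = segment ℝ v z := fun e he hve => by
    have h : e ∈ {e | ∃ (j : Fin k) (l : Fin (i j)), e = segment ℝ v (w j l)} := hwv ▸ ⟨he, hve⟩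
    obtain ⟨j, l, h⟩ := h
    exact ⟨_, h⟩
  have hbpos : ∀ p, 0 < inner ℝ n (W p - v) := fun p =>
    hn _ (mem_of_isEdge_segment (hedge p)).2 (ne_of_isEdge_segment (hedge p))
  have hb0 : ∀ p, W p - v ≠ 0 := fun p => sub_ne_zero.2 (ne_of_isEdge_segment (hedge p))
  have hGp : ∀ p : (j : Fin k) × Fin (i j), segment ℝ v (W p) ⊆ G p.1 p.2 ∧
      segment ℝ v (W (blockSucc hi p)) ⊆ G p.1 p.2 := fun p =>
    ⟨(hG p.1 p.2).2.1, by
      have := (hG p.1 p.2).2.2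
      rwa [blockNext_eq] at this⟩
  have hωpos : 0 < ω := by
    have h1 := hbpos ⟨0, ⟨0, hi 0⟩⟩
    have h2 := (face_facts hPc hnF (haj 0)).2.1 _
      (mem_of_isEdge_segment (hedge ⟨0, ⟨0, hi 0⟩⟩)).2
    have h3 := hna 0
    rw [inner_sub_right] at h1 h3
    linarith
  -- the cone of `P` at `v`
  have hlt : ∑ p : (j : Fin k) × Fin (i j), splitVol (W p - v) (W (blockSucc hi p) - v) <
      2 * MeasureTheory.volume.real (Metric.ball (0 : Space 3) 1) := by
    have hgex : ∀ p : (j : Fin k) × Fin (i j), ∃ g : Space 3, g ≠ 0 ∧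
        (∀ x ∈ P, inner ℝ g (x - v) ≤ 0) ∧ ∀ x ∈ G p.1 p.2, inner ℝ g (x - v) = 0 := by
      intro p
      obtain ⟨⟨g, hg0, hg⟩, -⟩ := (hG p.1 p.2).1
      obtain ⟨-, h1, h2⟩ := face_facts hPc hg ((hGp p).1 (left_mem_segment ℝ _ _))
      refine ⟨g, hg0, fun x hx => ?_, fun x hx => ?_⟩
      · rw [inner_sub_right]
        linarith [h1 x hx]
      · rw [inner_sub_right, ((h2 x).1 hx).2, sub_self]
    choose g hg0 hgle hgG using hgex
    refine sum_lt_two_mul_volume_ball hbpos (fun p => hbpos _) fun u _ _ s hs => ?_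
    exact card_crossing_le_two hPc hn hw (blockSucc_ne hi hk) (blockSucc_blockSucc_ne hi hk) hedge
      hg0 hgle (fun p => hgG p _ ((hGp p).1 (right_mem_segment ℝ _ _)))
      (fun p => hgG p _ ((hGp p).2 (right_mem_segment ℝ _ _))) hs
  -- the facets at distance `ω` from the vertices of `F`
  have hfacet : ∀ j, ∃ (l : Fin (i j)) (g : Space 3), ‖g‖ = 1 ∧ inner ℝ g (a j - v) = -ω ∧
      (∀ x ∈ P, inner ℝ g (x - v) ≤ 0) ∧ inner ℝ g (W ⟨j, l⟩ - v) = 0 ∧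
      ∃ α β : ℝ, 0 ≤ α ∧ 0 ≤ β ∧ a j - v + ω • g =
        α • (W ⟨j, l⟩ - v) + β • (W (blockSucc hi ⟨j, l⟩) - v) := by
    intro j
    obtain ⟨hall, l, hl⟩ := hc j
    obtain ⟨-, -, -, g, hg1, hgG, hga⟩ := hall l
    have hvG : v ∈ G j l := (hGp ⟨j, l⟩).1 (left_mem_segment ℝ _ _)
    have h1 := inner_sub_eq_minWidth hPc hg1 hgG hga hvG hl
    obtain ⟨-, h2, h3⟩ := face_facts hPc hgG hvG
    refine ⟨l, g, hg1, ?_, fun x hx => ?_, ?_, ?_⟩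
    · rw [inner_sub_right]
      linarith
    · rw [inner_sub_right]
      linarith [h2 x hx]
    · rw [inner_sub_right, ((h3 _).1 ((hGp ⟨j, l⟩).1 (right_mem_segment ℝ _ _))).2, sub_self]
    · exact foot_mem_cone hS hPS hn (hG j l).1 hedges (hedge _) (hedge _)
        (hw.ne (blockSucc_ne hi hk _).symm) (hGp ⟨j, l⟩).1 (hGp ⟨j, l⟩).2 hg1 hgG hga h1
  choose l g hg1 hga hgle hgW hcomb using hfacet
  -- Otherwise `g j = -n`, but `g j` vanishes on an edge at `v` along which `n` increases.
  have hx0 : ∀ j, a j - v - ω • n ≠ 0 := by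
    intro j h
    rw [sub_eq_zero] at h
    have h1 := hga j
    rw [h, real_inner_smul_right] at h1
    have h2 : inner ℝ (g j) n = -1 := by
      have : ω * (inner ℝ (g j) n + 1) = 0 := by linarith
      linarith [(mul_eq_zero.1 this).resolve_left hωpos.ne']
    have h3 : ‖g j + n‖ ^ 2 = 0 := by
      rw [norm_add_sq_real, h2, hg1, hn1]
      norm_num
    have h4 : n = -g j :=
      eq_neg_of_add_eq_zero_right (norm_eq_zero.1 (pow_eq_zero_iff two_ne_zero |>.1 h3))
    have h5 := hbpos ⟨j, l j⟩
    rw [h4, inner_neg_left, hgW, neg_zero] at h5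
    exact lt_irrefl _ h5
  have hge : 2 * MeasureTheory.volume.real (Metric.ball (0 : Space 3) 1) ≤
      ∑ j, splitVol (a (j - 1) - v - ω • n) (a j - v - ω • n) := by
    refine two_mul_volume_ball_le_sum (x := fun j => a j - v - ω • n) hx0 fun u => ?_
    obtain ⟨-, hF2, hF3⟩ := face_facts hPc hnF (haj 0)
    obtain ⟨-, hv2, hv3⟩ := face_facts hPc hnv rfl
    -- Optimality allows only tilts orthogonal to `n`, so `u` is projected; the projection pairs
    -- with `a j - v` as `u` does with `a j - v - ω • n`.
    obtain ⟨j, hj⟩ := Finite.exists_max fun j => inner ℝ (u - inner ℝ n u • n) (a j)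
    refine ⟨j, ?_⟩
    have h1 := le_of_minWidth_direction (m := n) (u := u - inner ℝ n u • n) hS hPS ⟨v, hvP⟩ hn1
      (by rw [inner_sub_right, real_inner_smul_right, real_inner_self_eq_norm_sq, hn1]; ring)
      (h := inner ℝ n (a 0)) (l := inner ℝ n v)
      (M := inner ℝ (u - inner ℝ n u • n) (a j)) (L := inner ℝ (u - inner ℝ n u • n) v) hF2
      (fun x hx => by
        have := hv2 x hx
        rw [inner_neg_left, inner_neg_left] at this
        linarith)
      (fun x hx hxn => by
        obtain ⟨j', hj'⟩ := exists_vertex_ge hS hPS hF haF (u - inner ℝ n u • n)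
          ((hF3 x).2 ⟨hx, hxn⟩)
        exact hj'.trans (hj j'))
      (fun x hx hxn => by
        have : x = v := (hv3 x).2 ⟨hx, by rw [inner_neg_left, inner_neg_left, hxn]⟩
        rw [this])
      (by rw [← inner_sub_right]; exact hna 0)
    have h2 := hna j
    rw [inner_sub_left, inner_sub_left, real_inner_smul_left, real_inner_smul_left] at h1
    rw [inner_sub_right] at h2
    rw [inner_sub_left, inner_sub_left, real_inner_smul_left, real_inner_comm u (a j),
      real_inner_comm u v]
    have h3 : inner ℝ n u * (inner ℝ n (a j) - inner ℝ n v) = inner ℝ n u * ω := by rw [h2]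
    linarith
  have hkey : ∀ j, splitVol (a (j - 1) - v - ω • n) (a j - v - ω • n) ≤
      splitVol (a (j - 1) - v + ω • g (j - 1)) (W ⟨j, ⟨0, hi j⟩⟩ - v) +
        splitVol (W ⟨j, ⟨0, hi j⟩⟩ - v) (a j - v + ω • g j) := by
    intro j
    obtain ⟨-, -, -, c, hc1, hcv, hca⟩ := hb j
    obtain ⟨-, h1, h2⟩ := face_facts hPc hcv (left_mem_segment ℝ _ _)
    obtain ⟨-, h3, h4⟩ := face_facts hPc hca (right_mem_segment ℝ _ _)
    have hW := (mem_of_isEdge_segment (hedge ⟨j, ⟨0, hi j⟩⟩)).2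
    -- Here `D` is the width of the slab between the supporting planes through the two antipodal
    -- edges, hence at least `ω`.
    refine splitVol_foot_le (c := -c) (D := inner ℝ (-c) (a j - v)) hn1 (hg1 j) (hg1 (j - 1))
      (by rwa [norm_neg]) hωpos.le ?_ (hb0 _) (hna j) (hna _) (hga j) (hga _) (hgle j _ hW)
      (hgle _ _ hW) ?_ rfl ?_ (hx0 j) (hx0 _)
    · rw [inner_sub_right]
      refine minWidth_le_sub hPc ⟨v, hvP⟩ (by rw [norm_neg, hc1]) h3 fun x hx => ?_
      rw [inner_neg_left, inner_neg_left]
      linarith [h1 x hx]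
    · rw [inner_neg_left, inner_sub_right, ((h2 _).1 (right_mem_segment ℝ _ _)).2, sub_self,
        neg_zero]
    · rw [inner_sub_right, inner_sub_right, ((h4 _).1 (left_mem_segment ℝ _ _)).2]
  have hblock : ∀ j, splitVol (W ⟨j, ⟨0, hi j⟩⟩ - v) (a j - v + ω • g j) +
      splitVol (a j - v + ω • g j) (W ⟨j + 1, ⟨0, hi (j + 1)⟩⟩ - v) ≤
      ∑ m : Fin (i j), splitVol (W ⟨j, m⟩ - v) (W (blockSucc hi ⟨j, m⟩) - v) := by
    intro j
    -- Past the end of block `j` the default is the first edge of the next block, so the chain has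
    -- exactly `i j` steps and ends there.
    set f : ℕ → Space 3 := fun m => if h : m < i j then W ⟨j, ⟨m, h⟩⟩ - v else
      W ⟨j + 1, ⟨0, hi (j + 1)⟩⟩ - v with hf
    have hf1 : ∀ m : Fin (i j), f m = W ⟨j, m⟩ - v := fun m => dif_pos m.2
    have hf2 : ∀ m : Fin (i j), f (m + 1) = W (blockSucc hi ⟨j, m⟩) - v := fun m => by
      by_cases h : m.val + 1 < i j
      · have e : blockSucc hi ⟨j, m⟩ = ⟨j, ⟨m.val + 1, h⟩⟩ := dif_pos h
        rw [e]
        exact dif_pos h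
      · have e : blockSucc hi ⟨j, m⟩ = ⟨j + 1, ⟨0, hi (j + 1)⟩⟩ := dif_neg h
        rw [e]
        exact dif_neg h
    have hf0 : ∀ m, f m ≠ 0 := fun m => by
      simp only [hf]
      split_ifs <;> exact hb0 _
    obtain ⟨α, β, hα, hβ, hq⟩ := hcomb j
    have h1 := splitVol_chain hf0 (q := a j - v + ω • g j) (l j).2
      (by rw [hf1, hf2]; exact splitVol_add_le hα hβ hq)
    have e0 : f 0 = W ⟨j, ⟨0, hi j⟩⟩ - v := dif_pos (hi j)
    have e1 : f (i j) = W ⟨j + 1, ⟨0, hi (j + 1)⟩⟩ - v := dif_neg (lt_irrefl _)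
    rw [e0, e1, Finset.sum_range] at h1
    simpa only [hf1, hf2] using h1
  -- Cyclic reindexing matches the angles before the first edge of each block with those left over
  -- at the end of the preceding block.
  have hshift : ∑ j, splitVol (a (j - 1) - v + ω • g (j - 1)) (W ⟨j, ⟨0, hi j⟩⟩ - v) =
      ∑ j, splitVol (a j - v + ω • g j) (W ⟨j + 1, ⟨0, hi (j + 1)⟩⟩ - v) := by
    refine (Equiv.sum_comp (Equiv.addRight (1 : Fin k)) fun j =>
      splitVol (a (j - 1) - v + ω • g (j - 1)) (W ⟨j, ⟨0, hi j⟩⟩ - v)).symm.trans ?_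
    refine Finset.sum_congr rfl fun j _ => ?_
    change splitVol (a (j + 1 - 1) - v + ω • g (j + 1 - 1)) _ = _
    rw [add_sub_cancel_right]
    rfl
  have h1 := Finset.sum_le_sum fun j (_ : j ∈ Finset.univ) => hkey j
  have h2 := Finset.sum_le_sum fun j (_ : j ∈ Finset.univ) => hblock j
  rw [Finset.sum_add_distrib] at h1 h2
  rw [Fintype.sum_sigma] at hlt
  linarith
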